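/- Notation. An index is a finite sequence $\mathbf k=(k_1,\dots,k_r)$ of positive integers; $I(k,r)$ is the (finite) set of all indices with $r$ entries and $k_1+\cdots+k_r=k$; $\{1\}_r$ is the index consisting of $r$ ones. For $n\ge 1$ the multiple $T$-harmonic sum is $$T_n(k_1,\dots,k_r)=2^r\sum \prod_{\substack{1\le j\le r\\ j\ \mathrm{odd}}}\frac1{(2n_j-1)^{k_j}}\prod_{\substack{1\le j\le r\\ j\ \mathrm{even}}}\frac1{(2n_j)^{k_j}},$$ where the sum runs over all positive integers $n_1,\dots,n_r$ with $n_1\le n_2<n_3\le n_4<\cdots$ ($n_j\le n_{j+1}$ for odd $j$, $n_j<n_{j+1}$ for even $j$), and $n_r\le n$ if $r$ is odd, $n_r<n$ if $r$ is even (an empty sum is $0$). The alternating multiple $T$-values and their sums over all indices of given weight and depth are $$\overline T(k_1,\dots,k_r)=2^r\sum_{0<n_1<\cdots<n_r}\frac{(-1)^{n_r}}{(2n_1-1)^{k_1}(2n_2-2)^{k_2}\cdots(2n_r-r)^{k_r}},\qquad W(k,r)=\sum_{\mathbf k\in I(k,r)}\overline T(\mathbf k),$$ where the series is understood as the limit,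 as $N\to\infty$, of the finite sums over $n_r\le N$. Put $\overline\zeta(k)=\sum_{n\ge1}(-1)^{n-1}n^{-k}$ for $k\ge1$, and for integers $1\le j\le p$ put $Z(p,p)=1$ and, if $j<p$, $$Z(j,p)=\sum_{k=1}^{p-j}(-2)^k\sum_{j=i_0<i_1<\cdots<i_k=p}\ \prod_{l=1}^k\overline\zeta(2i_l-2i_{l-1}).$$ Theorem. Let $m,p$ be positive integers. Then all the series $\overline T(\mathbf k)$ occurring in $W(2j+2m-1,2m)$, $1\le j\le p$, converge, the series on the left below converges, and $$\sum_{n=1}^\infty \frac{T_n(\{1\}_{2m-1})\,T_n(\{1\}_{2p-1})}{n}(-1)^n=(-1)^m\sum_{j=1}^p W(2j+2m-1,2m)\,Z(j,p).$$ -/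

import Mathlib

open Filter Topology

noncomputable section

/-- The multiple `T`-harmonic sum `T_n(k_1, …, k_r)` (the entry `k_{i+1}` of the index
is `k i` for `i : Fin r`; so `Even i` says that the one-based position `i + 1` is odd).
It is the sum of `∏ 2 / (2 n_j - 1)^{k_j}` (odd positions `j`), `2 / (2 n_j)^{k_j}` (even positions `j`)
over all positive integers with `n_1 ≤ n_2 < n_3 ≤ n_4 < ⋯`, where the chain ends in
`n_r ≤ n` if `r` is odd and in `n_r < n` if `r` is even. The sum is `0` if there are no such tuples,
and the sum for the empty index is `1`. -/
def multipleTHarmonicSum (n : ℕ) {r : ℕ} (k : Fin r → ℕ) : ℝ :=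
  ∑ ν ∈ (Fintype.piFinset fun _ : Fin r => Finset.Icc 1 n) with
      (∀ i j : Fin r, i.val + 1 = j.val → if Even i.val then ν i ≤ ν j else ν i < ν j) ∧
      (∀ i : Fin r, i.val + 1 = r → if Even i.val then ν i ≤ n else ν i < n),
    ∏ i : Fin r, 2 / (if Even i.val then 2 * (ν i : ℝ) - 1 else 2 * (ν i : ℝ)) ^ k i

/-- The sum defining the alternating multiple `T`-value `T̄(k_1, …, k_r)`, truncated at `n_r ≤ N`:
the sum of `2^r (-1)^{n_r} / ((2 n_1 - 1)^{k_1} (2 n_2 - 2)^{k_2} ⋯ (2 n_r - r)^{k_r})` over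
`0 < n_1 < ⋯ < n_r ≤ N`. -/
def altMTVPartialSum {r : ℕ} (k : Fin r → ℕ) (N : ℕ) : ℝ :=
  2 ^ r * ∑ ν ∈ (Fintype.piFinset fun _ : Fin r => Finset.Icc 1 N) with StrictMono ν,
    ∏ i : Fin r, (if i.val + 1 = r then (-1 : ℝ) ^ ν i else 1) /
      (2 * (ν i : ℝ) - ((i.val : ℝ) + 1)) ^ k i

/-- The alternating multiple `T`-value `T̄(k_1, …, k_r)` (the sign is attached to the last summation
variable `n_r`). For `k_r = 1` the series converges only conditionally, and it is summed according
to the largest summation variable. -/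
def altMTV {r : ℕ} (k : Fin r → ℕ) : ℝ :=
  limUnder atTop (altMTVPartialSum k)

/-- The set `I(w, r)` of all indices (tuples of positive integers) of weight `w` and depth `r`. -/
def indexSet (w r : ℕ) : Finset (Fin r → ℕ) :=
  {k ∈ Fintype.piFinset fun _ : Fin r => Finset.Icc 1 w | ∑ i, k i = w}

/-- The sum `W(w, r)` of all `T̄(k_1, …, k_r)` of weight `w` and depth `r`. -/
def sumW (w r : ℕ) : ℝ :=
  ∑ k ∈ indexSet w r, altMTV k

/-- The partial sums of `∑_{n ≥ 1} (-1)^{n-1} / n^k`. -/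
def altZetaPartialSum (k N : ℕ) : ℝ :=
  ∑ n ∈ Finset.Icc 1 N, (-1 : ℝ) ^ (n - 1) / (n : ℝ) ^ k

/-- The alternating zeta value `ζ̄(k) = ∑_{n ≥ 1} (-1)^{n-1} / n^k` for `k ≥ 1`, and `ζ̄(0) = 1/2`. -/
def altZeta (k : ℕ) : ℝ :=
  if k = 0 then 1 / 2 else limUnder atTop (altZetaPartialSum k)

/-- The limit in the definition of `altZeta` exists. -/
theorem tendsto_altZetaPartialSum {k : ℕ} (hk : 1 ≤ k) :
    Tendsto (altZetaPartialSum k) atTop (𝓝 (altZeta k)) := by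
  have hk0 : k ≠ 0 := by omega
  have hanti : Antitone fun n : ℕ => 1 / ((n : ℝ) + 1) ^ k := by
    intro a b hab
    have hab' : (a : ℝ) ≤ b := by exact_mod_cast hab
    dsimp only
    gcongr
  have hzero : Tendsto (fun n : ℕ => 1 / ((n : ℝ) + 1) ^ k) atTop (𝓝 0) := by
    have h := (tendsto_one_div_add_atTop_nhds_zero_nat (𝕜 := ℝ)).pow k
    simpa [hk0] using h
  obtain ⟨l, hl⟩ := hanti.tendsto_alternating_series_of_tendsto_zero hzero
  have heq : altZetaPartialSum k =
      fun N => ∑ n ∈ Finset.range N, (-1 : ℝ) ^ n * (1 / ((n : ℝ) + 1) ^ k) := by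
    funext N
    unfold altZetaPartialSum
    induction N with
    | zero => simp
    | succ N ih =>
      rw [Finset.sum_Icc_succ_top (by omega), ih, Finset.sum_range_succ]
      push_cast
      simp [div_eq_mul_inv]
  rw [← heq] at hl
  unfold altZeta
  rw [if_neg hk0]
  exact tendsto_nhds_limUnder ⟨l, hl⟩

/-- `Z(j, p) = ∑_{k=1}^{p-j} (-2)^k ∑_{j = i_0 < i_1 < ⋯ < i_k = p} ∏_{l=1}^k ζ̄(2 i_l - 2 i_{l-1})`
for `j < p`, and `Z(p, p) = 1`. -/
def coeffZ (j p : ℕ) : ℝ :=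
  if j = p then 1 else
    ∑ k ∈ Finset.Icc 1 (p - j), (-2 : ℝ) ^ k *
      ∑ i ∈ (Fintype.piFinset fun _ : Fin (k + 1) => Finset.Icc j p) with
          StrictMono i ∧ i 0 = j ∧ i (Fin.last k) = p,
        ∏ l : Fin k, altZeta (2 * i l.succ - 2 * i l.castSucc)

end

/-
Let `M_s(n) = n ∫₀¹ x ^ (n - 1) (-log t) ^ s / s! dx`, where `t = (1 - x) / (1 + x)`. The moments
`M_{2q+1}(2n)` and `M_{2q}(2n+1)` satisfy the same recursions in `n` as the sums `T_n({1}_{2q+1})`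
and `T_{n+1}({1}_{2q})`, but start from `M_{2q}(1) = 2 ζ̄(2q)` instead of `T_1({1}_{2q}) = δ_{q0}`.
So the generating series over `q` differ by the factor `∑ 2 ζ̄(2q) X ^ q`; its inverse has the
coefficients `Z(j, p)`, and `T_n({1}_{2p-1}) = ∑_j Z(j, p) M_{2j-1}(2n)`.

The alternating generating function of the `T_n({1}_r)` is `(2 arctan x) ^ r / (r! (1 + x ^ 2))`. By
Abel summation and the substitution `x ↦ t`, under which `arctan x` becomes `π / 4 - arctan t`, the
series on the left turns into a combination with coefficients `Z(j, p)` of the integrals over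
`(0, 1)` of `2 / (1 + t ^ 2)` times divided powers of `π / 2 - 2 arctan t` and of `-log t`. Repeated
integration by parts, along the differential equations of the polylogarithms with limits
`± W(r + s, r)` at `1`, evaluates these integrals.
-/

section Combinatorics

open Finset

theorem sum_eq_sum_snoc {α M : Type*} [AddCommMonoid M] {r : ℕ} {s : Finset (Fin (r + 1) → α)}
    {A : Finset α} {t : α → Finset (Fin r → α)}
    (h : ∀ ν n, Fin.snoc (α := fun _ => α) ν n ∈ s ↔ n ∈ A ∧ ν ∈ t n)
    (g : (Fin (r + 1) → α) → M) :
    ∑ ν ∈ s, g ν = ∑ n ∈ A, ∑ ν ∈ t n, g (Fin.snoc (α := fun _ => α) ν n) := by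
  rw [sum_sigma']
  refine sum_nbij' (fun ν => ⟨ν (Fin.last r), Fin.init ν⟩)
    (fun x => Fin.snoc (α := fun _ => α) x.2 x.1) (fun ν hν => ?_) (fun x hx => ?_)
    (fun ν _ => Fin.snoc_init_self ν) (fun x _ => by simp)
    (fun ν _ => congrArg g (Fin.snoc_init_self ν).symm)
  · rw [mem_sigma, ← h, Fin.snoc_init_self]
    exact hν
  · exact (h _ _).2 (mem_sigma.1 hx)

theorem sum_Icc_one_add_of_eq_zero {M : Type*} [AddCommMonoid M] {m : ℕ} {a : ℕ → M}
    (ha : ∀ n ∈ Icc 1 m, a n = 0) (K : ℕ) :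
    ∑ n ∈ Icc 1 (m + K), a n = ∑ i ∈ range K, a (m + 1 + i) := by
  induction K with
  | zero => simpa using sum_eq_zero ha
  | succ K ih => rw [← add_assoc, sum_Icc_succ_top (by omega), ih, sum_range_succ, add_right_comm]

theorem strictMono_snoc_iff {r : ℕ} {ν : Fin r → ℕ} {n : ℕ} :
    StrictMono (Fin.snoc (α := fun _ => ℕ) ν n) ↔ StrictMono ν ∧ ∀ i, ν i < n := by
  refine ⟨fun h => ⟨fun i j hij => ?_, fun i => ?_⟩, fun ⟨h, hn⟩ i j hij => ?_⟩
  · simpa using h (Fin.castSucc_lt_castSucc_iff.2 hij)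
  · simpa using h (Fin.castSucc_lt_last i)
  · cases j using Fin.lastCases with
    | last =>
      obtain ⟨i, rfl⟩ := Fin.exists_castSucc_eq.2 hij.ne
      simpa using hn i
    | cast j =>
      obtain ⟨i, rfl⟩ := Fin.exists_castSucc_eq.2 (hij.trans (Fin.castSucc_lt_last j)).ne
      simpa using h (Fin.castSucc_lt_castSucc_iff.1 hij)

/-- The strictly increasing `r`-tuples with entries in `{1, …, N}`. -/
def strictTuples (r N : ℕ) : Finset (Fin r → ℕ) :=
  {ν ∈ Fintype.piFinset fun _ : Fin r => Icc 1 N | StrictMono ν}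

theorem strictTuples_eq_empty {r N : ℕ} (h : N < r) : strictTuples r N = ∅ := by
  refine eq_empty_iff_forall_notMem.2 fun ν hν => ?_
  simp only [strictTuples, mem_filter, Fintype.mem_piFinset] at hν
  have hcard := card_le_card_of_injOn (s := univ) ν (fun i _ => hν.1 i) hν.2.injective.injOn
  rw [card_univ, Fintype.card_fin, Nat.card_Icc] at hcard
  omega

theorem snoc_mem_strictTuples {r N : ℕ} {ν : Fin r → ℕ} {n : ℕ} :
    Fin.snoc (α := fun _ => ℕ) ν n ∈ strictTuples (r + 1) N ↔
      n ∈ Icc 1 N ∧ ν ∈ strictTuples r (n - 1) := by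
  simp only [strictTuples, mem_filter, Fintype.mem_piFinset, Fin.forall_fin_succ',
    Fin.snoc_castSucc, Fin.snoc_last, strictMono_snoc_iff, mem_Icc]
  constructor
  · rintro ⟨⟨hν, hn⟩, hmono, hlt⟩
    exact ⟨hn, fun i => ⟨(hν i).1, Nat.le_sub_one_of_lt (hlt i)⟩, hmono⟩
  · rintro ⟨hn, hν, hmono⟩
    exact ⟨⟨fun i => ⟨(hν i).1, by have := hν i; omega⟩, hn⟩, hmono,
      fun i => by have := hν i; omega⟩

/-- The sum of `∏ (2 ν_l - l)^{-k_l}` (one-based `l`) over `0 < ν_1 < ⋯ < ν_r ≤ r + i`; its only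
term for `i = 0` comes from `ν = (1, …, r)`. -/
noncomputable def mtSum {r : ℕ} (k : Fin r → ℕ) (i : ℕ) : ℝ :=
  ∑ ν ∈ strictTuples r (r + i), ∏ l, 1 / (2 * (ν l : ℝ) - ((l.val : ℝ) + 1)) ^ k l

theorem sum_strictTuples_prod_mul {r : ℕ} (k : Fin (r + 1) → ℕ) (u : ℕ → ℝ) (K : ℕ) :
    ∑ ν ∈ strictTuples (r + 1) (r + K), (∏ l : Fin r,
        1 / (2 * (ν l.castSucc : ℝ) - ((l.val : ℝ) + 1)) ^ k l.castSucc) *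
      (u (ν (Fin.last r)) / (2 * (ν (Fin.last r) : ℝ) - ((r : ℝ) + 1)) ^ k (Fin.last r)) =
      ∑ j ∈ range K, u (r + 1 + j) * mtSum (Fin.init k) j /
        ((r : ℝ) + 1 + 2 * j) ^ k (Fin.last r) := by
  rw [sum_eq_sum_snoc fun _ _ => snoc_mem_strictTuples, sum_Icc_one_add_of_eq_zero]
  · refine sum_congr rfl fun j _ => ?_
    simp only [Fin.snoc_castSucc, Fin.snoc_last, ← sum_mul]
    rw [show r + 1 + j - 1 = r + j by omega, mul_comm (u _), mul_div_assoc]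
    congr 3
    push_cast
    ring
  · intro n hn
    rw [mem_Icc] at hn
    rw [strictTuples_eq_empty (by omega), sum_empty]

theorem mtSum_zero (k : Fin 0 → ℕ) (i : ℕ) : mtSum k i = 1 := by
  simp [mtSum, strictTuples, Subsingleton.strictMono]

theorem mtSum_succ {r : ℕ} (k : Fin (r + 1) → ℕ) (i : ℕ) :
    mtSum k i =
      ∑ j ∈ range (i + 1), mtSum (Fin.init k) j / ((r : ℝ) + 1 + 2 * j) ^ k (Fin.last r) := by
  have h := sum_strictTuples_prod_mul k (fun _ => 1) (i + 1)
  simp only [one_mul] at h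
  rw [← h, mtSum, show r + 1 + i = r + (i + 1) by ring]
  exact sum_congr rfl fun ν _ => Fin.prod_univ_castSucc _

theorem altMTVPartialSum_add {r : ℕ} (k : Fin (r + 1) → ℕ) (K : ℕ) :
    altMTVPartialSum k (r + K) = 2 ^ (r + 1) * ∑ j ∈ range K, (-1) ^ (r + 1 + j) *
      mtSum (Fin.init k) j / ((r : ℝ) + 1 + 2 * j) ^ k (Fin.last r) := by
  rw [← sum_strictTuples_prod_mul, altMTVPartialSum]
  congr 1
  refine sum_congr rfl fun ν _ => ?_
  rw [Fin.prod_univ_castSucc]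
  congr 1
  · refine prod_congr rfl fun l _ => ?_
    rw [if_neg (by simp only [Fin.val_castSucc]; omega), Fin.val_castSucc]
  · simp

theorem mem_indexSet {w r : ℕ} {k : Fin r → ℕ} :
    k ∈ indexSet w r ↔ (∀ i, 1 ≤ k i) ∧ ∑ i, k i = w := by
  simp only [indexSet, mem_filter, Fintype.mem_piFinset, mem_Icc]
  refine ⟨fun h => ⟨fun i => (h.1 i).1, h.2⟩, fun h => ⟨fun i => ⟨h.1 i, ?_⟩, h.2⟩⟩
  exact h.2 ▸ single_le_sum (fun _ _ => Nat.zero_le _) (mem_univ i)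

theorem sum_indexSet_succ {M : Type*} [AddCommMonoid M] {r s : ℕ} (g : (Fin (r + 1) → ℕ) → M) :
    ∑ k ∈ indexSet (r + 1 + s) (r + 1), g k =
      ∑ a ∈ range (s + 1), ∑ k ∈ indexSet (r + (s - a)) r,
        g (Fin.snoc (α := fun _ => ℕ) k (a + 1)) := by
  rw [sum_eq_sum_snoc (A := Icc 1 (s + 1)) (t := fun n => indexSet (r + (s + 1 - n)) r),
    ← zero_add (s + 1), sum_Icc_one_add_of_eq_zero (by simp)]
  · rw [zero_add]
    refine sum_congr rfl fun a _ => ?_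
    rw [show 0 + 1 + a = a + 1 by ring, Nat.add_sub_add_right]
  · intro k n
    simp only [mem_indexSet, Fin.forall_fin_succ', Fin.sum_univ_castSucc, Fin.snoc_castSucc,
      Fin.snoc_last, mem_Icc]
    have hr : (∀ i, 1 ≤ k i) → r ≤ ∑ i, k i := fun hk => by
      simpa using sum_le_sum fun i (_ : i ∈ univ) => hk i
    constructor
    · rintro ⟨⟨hk, hn⟩, hsum⟩
      have := hr hk
      exact ⟨⟨hn, by omega⟩, hk, by omega⟩
    · rintro ⟨hn, hk, hsum⟩
      exact ⟨⟨hk, hn.1⟩, by omega⟩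

/-- The shift `g_0, g_1, … ↦ 0, g_0, g_1, …` of a sequence. -/
def delay {M : Type*} [Zero M] (g : ℕ → M) : ℕ → M
  | 0 => 0
  | n + 1 => g n

/-- The sum of `2^r mtSum k i` over all indices `k` of depth `r` and weight `r + s`. -/
noncomputable def indexMTSum (r s i : ℕ) : ℝ :=
  2 ^ r * ∑ k ∈ indexSet (r + s) r, mtSum k i

/-- The `i`-th summand of `indexMTSum (r + 1) s`, coming from the tuples that end in `r + 1 + i`. -/
noncomputable def indexMTTerm (r s i : ℕ) : ℝ :=
  2 * ∑ a ∈ range (s + 1), indexMTSum r (s - a) i / ((r : ℝ) + 1 + 2 * i) ^ (a + 1)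

theorem indexMTSum_zero (s i : ℕ) : indexMTSum 0 s i = if s = 0 then 1 else 0 := by
  simp only [indexMTSum, mtSum_zero, sum_const, pow_zero, one_mul, zero_add, nsmul_one]
  split_ifs with h
  · subst h
    simp [indexSet]
  · simp [indexSet, Ne.symm h]

theorem two_pow_mul_sum_indexSet_mtSum (r s i : ℕ) :
    2 ^ (r + 1) * ∑ k ∈ indexSet (r + 1 + s) (r + 1),
      mtSum (Fin.init k) i / ((r : ℝ) + 1 + 2 * i) ^ k (Fin.last r) = indexMTTerm r s i := by
  simp only [sum_indexSet_succ, Fin.init_snoc, Fin.snoc_last, indexMTTerm, indexMTSum,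
    pow_succ', mul_assoc, mul_sum, sum_div, mul_div_assoc]

theorem indexMTSum_succ (r s i : ℕ) :
    indexMTSum (r + 1) s i = ∑ j ∈ range (i + 1), indexMTTerm r s j := by
  simp only [indexMTSum, mtSum_succ, ← two_pow_mul_sum_indexSet_mtSum, mul_sum]
  exact sum_comm

theorem sum_altMTVPartialSum (r s K : ℕ) :
    ∑ k ∈ indexSet (r + 1 + s) (r + 1), altMTVPartialSum k (r + K) =
      (-1) ^ (r + 1) * ∑ j ∈ range K, (-1) ^ j * indexMTTerm r s j := by
  simp only [altMTVPartialSum_add, ← two_pow_mul_sum_indexSet_mtSum, mul_sum]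
  rw [sum_comm]
  refine sum_congr rfl fun j _ => sum_congr rfl fun k _ => ?_
  rw [pow_add (-1 : ℝ)]
  ring

theorem indexMTTerm_mul (r s i : ℕ) :
    indexMTTerm r s i * ((r : ℝ) + 1 + 2 * i) =
      delay (indexMTTerm r · i) s + 2 * indexMTSum r s i := by
  have hne : (r : ℝ) + 1 + 2 * i ≠ 0 := by positivity
  cases s with
  | zero => simp [indexMTTerm, delay, mul_assoc, hne]
  | succ s =>
    simp only [indexMTTerm, delay]
    generalize (r : ℝ) + 1 + 2 * i = d at hne ⊢
    rw [sum_range_succ' _ (s + 1)]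
    simp only [Nat.add_sub_add_right, Nat.sub_zero, zero_add, pow_one, pow_succ _ (_ + 1),
      ← div_div, ← sum_div]
    field_simp

/-- `T_n({1}_r)`. -/
noncomputable def onesTSum (r n : ℕ) : ℝ :=
  multipleTHarmonicSum n fun _ : Fin r => 1

/-- The tuples over which `multipleTHarmonicSum n` is summed. -/
def chainTuples (r n : ℕ) : Finset (Fin r → ℕ) :=
  {ν ∈ Fintype.piFinset fun _ : Fin r => Icc 1 n |
    (∀ i j : Fin r, i.val + 1 = j.val → if Even i.val then ν i ≤ ν j else ν i < ν j) ∧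
      (∀ i : Fin r, i.val + 1 = r → if Even i.val then ν i ≤ n else ν i < n)}

theorem monotone_of_mem_chainTuples {r n : ℕ} {ν : Fin r → ℕ} (h : ν ∈ chainTuples r n) :
    Monotone ν := by
  cases r with
  | zero => exact fun i => i.elim0
  | succ r =>
    refine Fin.monotone_iff_le_succ.2 fun i => ?_
    have hi := (mem_filter.1 h).2.1 i.castSucc i.succ (by simp)
    split_ifs at hi <;> omega

theorem snoc_mem_chainTuples {r N : ℕ} {ν : Fin r → ℕ} {n : ℕ} :
    Fin.snoc (α := fun _ => ℕ) ν n ∈ chainTuples (r + 1) N ↔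
      n ∈ Icc 1 (N - r % 2) ∧ ν ∈ chainTuples r n := by
  have hlast : (1 ≤ n ∧ if Even r then n ≤ N else n < N) ↔ n ∈ Icc 1 (N - r % 2) := by
    rw [mem_Icc]
    split_ifs with hr <;> rw [Nat.even_iff] at hr <;> omega
  rw [← hlast]
  constructor
  · intro h
    have hmono := monotone_of_mem_chainTuples h
    simp only [chainTuples, mem_filter, Fintype.mem_piFinset, mem_Icc] at h ⊢
    obtain ⟨hν, hc, hl⟩ := h
    refine ⟨⟨by simpa using (hν (Fin.last r)).1, by simpa using hl (Fin.last r) rfl⟩,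
      fun i => ⟨by simpa using (hν i.castSucc).1, by simpa using hmono (Fin.le_last i.castSucc)⟩,
      fun i j hij => by simpa using hc i.castSucc j.castSucc hij,
      fun i hi => by simpa using hc i.castSucc (Fin.last r) hi⟩
  · simp only [chainTuples, mem_filter, Fintype.mem_piFinset, mem_Icc, Fin.forall_fin_succ',
      Fin.snoc_castSucc, Fin.snoc_last, Fin.val_castSucc, Fin.val_last]
    rintro ⟨⟨hn, hnN⟩, hν, hc, hl⟩
    have hle : n ≤ N := by split_ifs at hnN <;> omega
    exact ⟨⟨fun i => ⟨(hν i).1, (hν i).2.trans hle⟩, hn, hle⟩,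
      ⟨fun i => ⟨hc i, hl i⟩, fun i hi => by omega, fun h => by omega⟩,
      fun i hi => by omega, fun _ => hnN⟩

theorem onesTSum_zero (n : ℕ) : onesTSum 0 n = 1 := by
  simp [onesTSum, multipleTHarmonicSum]

theorem onesTSum_succ (r N : ℕ) :
    onesTSum (r + 1) N =
      ∑ n ∈ Icc 1 (N - r % 2), 2 / (2 * (n : ℝ) - 1 + (r % 2 : ℕ)) * onesTSum r n := by
  change ∑ ν ∈ chainTuples (r + 1) N, _ = _
  rw [sum_eq_sum_snoc fun _ _ => snoc_mem_chainTuples]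
  refine sum_congr rfl fun n _ => ?_
  simp only [onesTSum, multipleTHarmonicSum, Fin.prod_univ_castSucc, Fin.snoc_castSucc,
    Fin.snoc_last, Fin.val_castSucc, Fin.val_last, pow_one, ← sum_mul]
  rw [mul_comm]
  congr 2
  rcases Nat.mod_two_eq_zero_or_one r with h | h <;> simp [Nat.even_iff, h]

theorem onesTSum_succ_mod_two (r : ℕ) : onesTSum (r + 1) (r % 2) = 0 := by
  simp [onesTSum_succ]

theorem onesTSum_succ_add (r n : ℕ) :
    onesTSum (r + 1) (n + 1 + r % 2) = onesTSum (r + 1) (n + r % 2) +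
      2 / (2 * (n : ℝ) + 1 + (r % 2 : ℕ)) * onesTSum r (n + 1) := by
  simp only [onesTSum_succ r, Nat.add_sub_cancel]
  rw [sum_Icc_succ_top (by omega)]
  congr 3
  push_cast
  ring

theorem onesTSum_eq_zero {r n : ℕ} (hr : r ≠ 0) (hn : n ≤ r / 2) : onesTSum r n = 0 := by
  induction r generalizing n with
  | zero => exact absurd rfl hr
  | succ r ih =>
    rw [onesTSum_succ]
    refine sum_eq_zero fun j hj => ?_
    rw [mem_Icc] at hj
    rw [ih (by omega) (by omega), mul_zero]

theorem onesTSum_add (r i : ℕ) : onesTSum r (r / 2 + 1 + i) = indexMTSum r 0 i := by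
  induction r generalizing i with
  | zero => rw [onesTSum_zero, indexMTSum_zero, if_pos rfl]
  | succ r ih =>
    rw [onesTSum_succ, indexMTSum_succ,
      show (r + 1) / 2 + 1 + i - r % 2 = r / 2 + (i + 1) by omega, sum_Icc_one_add_of_eq_zero]
    · refine sum_congr rfl fun j _ => ?_
      have hr : (r : ℝ) = 2 * (r / 2 : ℕ) + (r % 2 : ℕ) := by
        exact_mod_cast (Nat.div_add_mod r 2).symm
      rw [ih, indexMTTerm, zero_add, sum_range_one, Nat.sub_zero, zero_add, pow_one]
      conv_rhs => rw [hr]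
      push_cast
      ring
    · intro n hn
      rw [mem_Icc] at hn
      rw [onesTSum_eq_zero (by omega) hn.2, mul_zero]

/-- The strictly increasing chains `j = i_0 < ⋯ < i_k = p`. -/
def strictChains (k j p : ℕ) : Finset (Fin (k + 1) → ℕ) :=
  {i ∈ Fintype.piFinset fun _ : Fin (k + 1) => Icc j p |
    StrictMono i ∧ i 0 = j ∧ i (Fin.last k) = p}

theorem snoc_mem_strictChains {k j p : ℕ} {i : Fin (k + 1) → ℕ} {n : ℕ} :
    Fin.snoc (α := fun _ => ℕ) i n ∈ strictChains (k + 1) j p ↔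
      n ∈ ({p} : Finset ℕ) ∧ i ∈ (Ico j p).biUnion fun q => strictChains k j q := by
  simp only [strictChains, mem_filter, Fintype.mem_piFinset, Fin.forall_fin_succ' (n := k + 1),
    Fin.snoc_castSucc, Fin.snoc_last, Fin.snoc_apply_zero, strictMono_snoc_iff, mem_Icc,
    mem_singleton, mem_biUnion, mem_Ico]
  constructor
  · rintro ⟨⟨hi, hn⟩, ⟨hmono, hlt⟩, h0, rfl⟩
    exact ⟨rfl, i (Fin.last k), ⟨(hi _).1, hlt _⟩,
      fun l => ⟨(hi l).1, hmono.monotone (Fin.le_last l)⟩, hmono, h0, rfl⟩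
  · rintro ⟨rfl, q, ⟨hjq, hqn⟩, hi, hmono, h0, hl⟩
    exact ⟨⟨fun l => ⟨(hi l).1, (hi l).2.trans hqn.le⟩, by omega, le_rfl⟩,
      ⟨hmono, fun l => (hi l).2.trans_lt hqn⟩, h0, rfl⟩

theorem strictChains_zero (j p : ℕ) :
    strictChains 0 j p = if j = p then {fun _ => j} else ∅ := by
  ext i
  have hi : i = (fun _ => i 0) := funext fun l => congrArg i (Subsingleton.elim (α := Fin 1) l 0)
  have hmono : StrictMono i := Subsingleton.strictMono (α := Fin 1) i
  simp only [strictChains, mem_filter, Fintype.mem_piFinset, mem_Icc, hmono, true_and]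
  split_ifs with hjp
  · subst hjp
    rw [mem_singleton]
    refine ⟨fun h => hi.trans (by rw [h.2.1]), ?_⟩
    rintro rfl
    simp
  · exact iff_of_false (fun h => hjp (h.2.1.symm.trans h.2.2)) (notMem_empty i)

theorem sum_strictChains_prod_coeff {R : Type*} [CommSemiring R] {φ : PowerSeries R}
    (hφ : PowerSeries.constantCoeff φ = 0) (k j d : ℕ) :
    ∑ i ∈ strictChains k j (j + d), ∏ l : Fin k, PowerSeries.coeff (i l.succ - i l.castSucc) φ =
      PowerSeries.coeff d (φ ^ k) := by
  induction k generalizing d with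
  | zero =>
    rw [strictChains_zero, pow_zero, PowerSeries.coeff_one]
    cases d <;> simp
  | succ k ih =>
    rw [sum_eq_sum_snoc fun _ _ => snoc_mem_strictChains, sum_singleton, sum_biUnion]
    · have hq : ∀ q, ∑ i ∈ strictChains k j q, ∏ l : Fin (k + 1),
          PowerSeries.coeff (Fin.snoc (α := fun _ => ℕ) i (j + d) l.succ -
            Fin.snoc (α := fun _ => ℕ) i (j + d) l.castSucc) φ =
          (∑ i ∈ strictChains k j q, ∏ l : Fin k,
            PowerSeries.coeff (i l.succ - i l.castSucc) φ) * PowerSeries.coeff (j + d - q) φ := by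
        intro q
        rw [sum_mul]
        refine sum_congr rfl fun i hi => ?_
        simp only [Fin.prod_univ_castSucc, Fin.succ_castSucc, Fin.succ_last, Fin.snoc_castSucc,
          Fin.snoc_last, (mem_filter.1 hi).2.2.2]
      rw [sum_congr rfl fun q _ => hq q, sum_Ico_eq_sum_range, pow_succ, PowerSeries.coeff_mul,
        Nat.sum_antidiagonal_eq_sum_range_succ_mk, sum_range_succ, Nat.sub_self,
        PowerSeries.coeff_zero_eq_constantCoeff_apply, hφ, mul_zero, add_zero,
        Nat.add_sub_cancel_left]
      refine sum_congr rfl fun e _ => ?_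
      rw [ih, Nat.add_sub_add_left]
    · refine fun q _ q' _ hqq' => disjoint_left.2 fun i hi hi' => hqq' ?_
      rw [← (mem_filter.1 hi).2.2.2, (mem_filter.1 hi').2.2.2]

/-- The power series `∑ 2 ζ̄(2 q) X ^ q`, whose inverse has the coefficients `Z(j, j + d)`; its
constant coefficient is `1` by the convention `ζ̄(0) = 1/2`. -/
noncomputable def evenAltZetaSeries : PowerSeries ℝ :=
  PowerSeries.mk fun q => 2 * altZeta (2 * q)

theorem constantCoeff_evenAltZetaSeries : PowerSeries.constantCoeff evenAltZetaSeries = 1 := by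
  rw [← PowerSeries.coeff_zero_eq_constantCoeff_apply, evenAltZetaSeries, PowerSeries.coeff_mk]
  norm_num [altZeta]

theorem coeff_inv_eq_sum_coeff_pow {K : Type*} [Field K] {φ : PowerSeries K}
    (hφ : PowerSeries.constantCoeff φ = 1) (d : ℕ) :
    PowerSeries.coeff d φ⁻¹ = ∑ k ∈ range (d + 1), PowerSeries.coeff d ((1 - φ) ^ k) := by
  have hφ' : PowerSeries.constantCoeff φ ≠ 0 := by rw [hφ]; exact one_ne_zero
  have hX : PowerSeries.X ^ (d + 1) ∣ (1 - φ) ^ (d + 1) :=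
    pow_dvd_pow_of_dvd (PowerSeries.X_dvd_iff.2 (by rw [map_sub, hφ, map_one, sub_self])) _
  have hgeom : φ⁻¹ = ∑ k ∈ range (d + 1), (1 - φ) ^ k + (1 - φ) ^ (d + 1) * φ⁻¹ := by
    have h := mul_neg_geom_sum (1 - φ) (d + 1)
    have hinv := PowerSeries.mul_inv_cancel φ hφ'
    rw [sub_sub_cancel] at h
    linear_combination (∑ k ∈ range (d + 1), (1 - φ) ^ k) * hinv - φ⁻¹ * h
  rw [hgeom, map_add, PowerSeries.X_pow_dvd_iff.1 (hX.mul_right _) d (Nat.lt_succ_self d),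
    add_zero, map_sum]

theorem coeffZ_add (j d : ℕ) : coeffZ j (j + d) = PowerSeries.coeff d evenAltZetaSeries⁻¹ := by
  have hconst : PowerSeries.constantCoeff (1 - evenAltZetaSeries) = 0 := by
    rw [map_sub, constantCoeff_evenAltZetaSeries, map_one, sub_self]
  have hprod : ∀ k, ∀ i ∈ strictChains k j (j + d),
      ∏ l : Fin k, PowerSeries.coeff (i l.succ - i l.castSucc) (1 - evenAltZetaSeries) =
        (-2) ^ k * ∏ l : Fin k, altZeta (2 * i l.succ - 2 * i l.castSucc) := by
    intro k i hi
    rw [← Fin.prod_const, ← prod_mul_distrib]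
    refine prod_congr rfl fun l _ => ?_
    have hlt := (mem_filter.1 hi).2.1 (Fin.castSucc_lt_succ (i := l))
    rw [map_sub, PowerSeries.coeff_one, if_neg (by omega), evenAltZetaSeries,
      PowerSeries.coeff_mk, Nat.mul_sub]
    ring
  rw [coeff_inv_eq_sum_coeff_pow constantCoeff_evenAltZetaSeries]
  simp only [← sum_strictChains_prod_coeff hconst _ j, sum_congr rfl (hprod _), ← mul_sum]
  rw [sum_range_succ', strictChains_zero, coeffZ, Nat.add_sub_cancel_left]
  split_ifs with hd
  · obtain rfl : d = 0 := by omega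
    simp
  · rw [sum_empty, mul_zero, add_zero, range_eq_Ico, sum_Ico_add' fun k => (-2 : ℝ) ^ k *
      ∑ i ∈ strictChains k j (j + d), ∏ l : Fin k, altZeta (2 * i l.succ - 2 * i l.castSucc)]
    rfl

end Combinatorics

section Growth

open Finset Asymptotics

theorem exists_tendsto_alternating_of_summable_sub {f : ℕ → ℝ} (h0 : Tendsto f atTop (𝓝 0))
    (hsum : Summable fun n => f (n + 1) - f n) :
    ∃ l, Tendsto (fun N => ∑ j ∈ range N, (-1) ^ j * f j) atTop (𝓝 l) := by
  have hbyparts : ∀ N, ∑ j ∈ range N, (-1) ^ j * f j =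
      (f 0 - (-1) ^ N * f N - ∑ j ∈ range N, (-1) ^ j * (f (j + 1) - f j)) / 2 := by
    intro N
    induction N with
    | zero => simp
    | succ N ih =>
      rw [sum_range_succ, sum_range_succ, ih]
      ring
  have hsum' : Summable fun n => (-1) ^ n * (f (n + 1) - f n) :=
    hsum.abs.of_norm_bounded fun n => by simp
  have hend : Tendsto (fun N => (-1) ^ N * f N) atTop (𝓝 0) :=
    squeeze_zero_norm (fun n => by simp) (tendsto_zero_iff_abs_tendsto_zero _ |>.1 h0)
  simp only [hbyparts]
  exact ⟨_, ((tendsto_const_nhds.sub hend).sub hsum'.hasSum.tendsto_sum_nat).div_const 2⟩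

/-- `f n` is of order at most `n ^ a` and its increments are of order at most `n ^ (a - 1)`; the
base is shifted to `n + 1` so that it never vanishes. -/
structure PowerGrowth (a : ℝ) (f : ℕ → ℝ) : Prop where
  isBigO : f =O[atTop] fun n => ((n : ℝ) + 1) ^ a
  isBigO_sub : (fun n => f (n + 1) - f n) =O[atTop] fun n => ((n : ℝ) + 1) ^ (a - 1)

theorem isBigO_succ_rpow {a b : ℝ} (hab : a ≤ b) :
    (fun n : ℕ => ((n : ℝ) + 1) ^ a) =O[atTop] fun n : ℕ => ((n : ℝ) + 1) ^ b := by
  refine IsBigO.of_norm_le fun n => ?_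
  rw [Real.norm_of_nonneg (by positivity)]
  exact Real.rpow_le_rpow_of_exponent_le (by linarith [n.cast_nonneg (α := ℝ)]) hab

theorem tendsto_succ_rpow_neg {a : ℝ} (ha : 0 < a) :
    Tendsto (fun n : ℕ => ((n : ℝ) + 1) ^ (-a)) atTop (𝓝 0) :=
  (tendsto_rpow_neg_atTop ha).comp
    (tendsto_atTop_add_const_right _ _ tendsto_natCast_atTop_atTop)

theorem summable_succ_rpow {a : ℝ} (ha : a < -1) :
    Summable fun n : ℕ => ((n : ℝ) + 1) ^ a := by
  simpa using (summable_nat_add_iff 1).2 (Real.summable_nat_rpow.2 ha)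

theorem mul_succ_rpow_sub_one_le {a : ℝ} (ha : 0 ≤ a) (ha1 : a ≤ 1) (n : ℕ) :
    a * ((n : ℝ) + 1) ^ (a - 1) ≤ ((n : ℝ) + 1) ^ a - (n : ℝ) ^ a := by
  have hn : (0 : ℝ) < n + 1 := by positivity
  have hbase : (n : ℝ) = (n + 1) * (1 + -1 / ((n : ℝ) + 1)) := by field_simp; ring
  have hneg : -1 ≤ -1 / ((n : ℝ) + 1) := by
    rw [le_div_iff₀ hn]
    linarith
  have hbernoulli := rpow_one_add_le_one_add_mul_self hneg ha ha1
  have hle : (n : ℝ) ^ a ≤ (n + 1) ^ a * (1 + a * (-1 / ((n : ℝ) + 1))) := by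
    conv_lhs => rw [hbase, Real.mul_rpow hn.le (by linarith)]
    gcongr
  rw [Real.rpow_sub_one hn.ne']
  linear_combination hle

namespace PowerGrowth

variable {a b : ℝ} {f g : ℕ → ℝ}

theorem isBigO_succ (hf : PowerGrowth a f) :
    (fun n => f (n + 1)) =O[atTop] fun n => ((n : ℝ) + 1) ^ a := by
  simpa using hf.isBigO.add (hf.isBigO_sub.trans (isBigO_succ_rpow (by linarith)))

theorem mono (hf : PowerGrowth a f) (hab : a ≤ b) : PowerGrowth b f :=
  ⟨hf.isBigO.trans (isBigO_succ_rpow hab), hf.isBigO_sub.trans (isBigO_succ_rpow (by linarith))⟩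

theorem const (ha : 0 ≤ a) (c : ℝ) : PowerGrowth a fun _ => c where
  isBigO := (isBigO_const_const c one_ne_zero _).trans (by simpa using isBigO_succ_rpow ha)
  isBigO_sub := by simpa using isBigO_zero _ _

theorem mul (hf : PowerGrowth a f) (hg : PowerGrowth b g) :
    PowerGrowth (a + b) fun n => f n * g n where
  isBigO := (hf.isBigO.mul hg.isBigO).congr_right fun n => (Real.rpow_add (by positivity) _ _).symm
  isBigO_sub := by
    have h₁ := (hf.isBigO_succ.mul hg.isBigO_sub).congr_right
      fun n => (Real.rpow_add (by positivity) _ _).symm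
    have h₂ := (hf.isBigO_sub.mul hg.isBigO).congr_right
      fun n => (Real.rpow_add (by positivity) _ _).symm
    rw [← add_sub_assoc] at h₁
    rw [sub_add_eq_add_sub] at h₂
    refine (h₁.add h₂).congr_left fun n => ?_
    ring

theorem const_mul (hf : PowerGrowth a f) (c : ℝ) : PowerGrowth a fun n => c * f n := by
  simpa using (const le_rfl c).mul hf

theorem sum {ι : Type*} {s : Finset ι} {F : ι → ℕ → ℝ} (hF : ∀ i ∈ s, PowerGrowth a (F i)) :
    PowerGrowth a fun n => ∑ i ∈ s, F i n where
  isBigO := IsBigO.fun_sum fun i hi => (hF i hi).isBigO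
  isBigO_sub := by
    simpa only [← sum_sub_distrib] using IsBigO.fun_sum fun i hi => (hF i hi).isBigO_sub

theorem of_isBigO_sub (ha : 0 < a) (ha1 : a ≤ 1)
    (hf : (fun n => f (n + 1) - f n) =O[atTop] fun n => ((n : ℝ) + 1) ^ (a - 1)) :
    PowerGrowth a f := by
  refine ⟨?_, hf⟩
  obtain ⟨C, hC, hbound⟩ := bound_of_isBigO_nat_atTop hf
  have hsub : ∀ n : ℕ, |f (n + 1) - f n| ≤ C * ((n : ℝ) + 1) ^ (a - 1) := fun n => by
    have hn : 0 < ((n : ℝ) + 1) ^ (a - 1) := by positivity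
    simpa only [Real.norm_eq_abs, abs_of_pos hn] using hbound hn.ne'
  have hle : ∀ n : ℕ, |f n| ≤ |f 0| + C / a * (n : ℝ) ^ a := by
    intro n
    induction n with
    | zero => simp [ha.ne']
    | succ n ih =>
      have htri := abs_add_le (f n) (f (n + 1) - f n)
      rw [add_sub_cancel] at htri
      have hstep : C * ((n : ℝ) + 1) ^ (a - 1) ≤
          C / a * (((n : ℝ) + 1) ^ a - (n : ℝ) ^ a) := by
        rw [div_mul_eq_mul_div, le_div_iff₀ ha, mul_assoc, mul_comm _ a]
        exact mul_le_mul_of_nonneg_left (mul_succ_rpow_sub_one_le ha.le ha1 n) hC.le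
      push_cast
      linarith [hsub n]
  refine IsBigO.trans (IsBigO.of_norm_le fun n => (hle n).trans ?_)
    ((const ha.le |f 0|).isBigO.add ((isBigO_refl _ _).const_mul_left (C / a)))
  gcongr
  linarith

theorem one_div {c : ℝ} (hc : 1 ≤ c) : PowerGrowth (-1) fun n => 1 / (c + 2 * (n : ℝ)) where
  isBigO := by
    refine IsBigO.of_norm_le fun n => ?_
    have : (0 : ℝ) ≤ n := n.cast_nonneg
    rw [Real.norm_of_nonneg (by positivity), Real.rpow_neg_one, ← _root_.one_div]
    exact one_div_le_one_div_of_le (by positivity) (by linarith)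
  isBigO_sub := by
    refine IsBigO.of_bound 2 (Eventually.of_forall fun n => ?_)
    have : (0 : ℝ) ≤ n := n.cast_nonneg
    have hsub : 1 / (c + 2 * ((n + 1 : ℕ) : ℝ)) - 1 / (c + 2 * (n : ℝ)) =
        -(2 / ((c + 2 * n) * (c + 2 * (n + 1)))) := by
      push_cast
      field_simp
      ring
    rw [hsub, norm_neg, Real.norm_of_nonneg (by positivity), Real.norm_of_nonneg (by positivity),
      show (-1 : ℝ) - 1 = -(2 : ℕ) by norm_num, Real.rpow_neg (by positivity), Real.rpow_natCast,
      ← div_eq_mul_inv]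
    gcongr
    nlinarith

theorem div_pow (hf : PowerGrowth a f) {c : ℝ} (hc : 1 ≤ c) {k : ℕ} (hk : 1 ≤ k) :
    PowerGrowth (a - 1) fun n => f n / (c + 2 * (n : ℝ)) ^ k := by
  induction k, hk using Nat.le_induction with
  | base => simpa [sub_eq_add_neg, div_eq_mul_inv] using hf.mul (one_div hc)
  | succ k _ ih =>
    simpa only [div_mul_div_comm, mul_one, ← pow_succ] using
      (ih.mul (one_div hc)).mono (show a - 1 + -1 ≤ a - 1 by linarith)

theorem exists_tendsto_alternating (ha : a < 0) (hf : PowerGrowth a f) :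
    ∃ l, Tendsto (fun N => ∑ j ∈ range N, (-1) ^ j * f j) atTop (𝓝 l) := by
  refine exists_tendsto_alternating_of_summable_sub (hf.isBigO.trans_tendsto ?_)
    (summable_of_isBigO_nat (summable_succ_rpow (by linarith)) hf.isBigO_sub)
  simpa using tendsto_succ_rpow_neg (neg_pos.2 ha)

theorem summable_mul_pow (hf : PowerGrowth a f) (ha : a ≤ 1) {y : ℝ} (hy : |y| < 1) :
    Summable fun n => f n * y ^ n := by
  have hgeom : Summable fun n : ℕ => ((n : ℝ) + 1) ^ (1 : ℝ) * y ^ n := by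
    simpa [add_mul] using
      (summable_pow_mul_geometric_of_norm_lt_one 1 hy).add (summable_geometric_of_norm_lt_one hy)
  exact summable_of_isBigO_nat hgeom.norm
    (((hf.mono ha).isBigO.mul (isBigO_refl _ _)).norm_right)

end PowerGrowth

theorem powerGrowth_mtSum {a : ℝ} (ha : 0 < a) (ha1 : a ≤ 1) {r : ℕ} {k : Fin r → ℕ}
    (hk : ∀ i, 1 ≤ k i) : PowerGrowth a (mtSum k) := by
  induction r with
  | zero => simpa only [funext (mtSum_zero k)] using PowerGrowth.const ha.le 1
  | succ r ih =>
    have hterm := (ih (k := Fin.init k) fun i => hk _).div_pow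
      (c := (r : ℝ) + 1) (by simp) (hk (Fin.last r))
    refine PowerGrowth.of_isBigO_sub ha ha1 (hterm.isBigO_succ.congr_left fun n => ?_)
    rw [mtSum_succ, mtSum_succ, sum_range_succ _ (n + 1), add_sub_cancel_left]

theorem tendsto_altMTVPartialSum {r : ℕ} {k : Fin (r + 1) → ℕ} (hk : ∀ i, 1 ≤ k i) :
    Tendsto (altMTVPartialSum k) atTop (𝓝 (altMTV k)) := by
  refine tendsto_nhds_limUnder ?_
  have hterm : PowerGrowth (1 / 2 - 1)
      fun j => mtSum (Fin.init k) j / ((r : ℝ) + 1 + 2 * j) ^ k (Fin.last r) :=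
    (powerGrowth_mtSum (by norm_num) (by norm_num) fun i => hk _).div_pow (by simp) (hk _)
  obtain ⟨l, hl⟩ := hterm.exists_tendsto_alternating (by norm_num)
  refine ⟨2 ^ (r + 1) * ((-1) ^ (r + 1) * l), (tendsto_add_atTop_iff_nat r).1 ?_⟩
  refine ((hl.const_mul _).const_mul _).congr fun K => ?_
  rw [add_comm K, altMTVPartialSum_add, mul_sum]
  simp only [pow_add, mul_assoc, mul_div_assoc]

theorem powerGrowth_indexMTSum {a : ℝ} (ha : 0 < a) (ha1 : a ≤ 1) (r s : ℕ) :
    PowerGrowth a (indexMTSum r s) :=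
  (PowerGrowth.sum fun _ hk => powerGrowth_mtSum ha ha1 (mem_indexSet.1 hk).1).const_mul (2 ^ r)

theorem powerGrowth_indexMTTerm {a : ℝ} (ha : 0 < a) (ha1 : a ≤ 1) (r s : ℕ) :
    PowerGrowth (a - 1) (indexMTTerm r s) :=
  (PowerGrowth.sum fun b _ => (powerGrowth_indexMTSum ha ha1 r (s - b)).div_pow (by simp)
    b.succ_pos).const_mul 2

theorem tendsto_sum_alternating_indexMTTerm (r s : ℕ) :
    Tendsto (fun K => ∑ j ∈ range K, (-1) ^ j * indexMTTerm r s j) atTop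
      (𝓝 ((-1) ^ (r + 1) * sumW (r + 1 + s) (r + 1))) := by
  have hsum : Tendsto (fun K => ∑ k ∈ indexSet (r + 1 + s) (r + 1), altMTVPartialSum k (K + r))
      atTop (𝓝 (sumW (r + 1 + s) (r + 1))) :=
    tendsto_finsetSum _ fun k hk => (tendsto_add_atTop_iff_nat r).2
      (tendsto_altMTVPartialSum (mem_indexSet.1 hk).1)
  refine (hsum.const_mul _).congr fun K => ?_
  simp only [add_comm K r]
  rw [sum_altMTVPartialSum, ← mul_assoc, ← mul_pow]
  simp

end Growth

section LogarithmicIntegrals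

open Finset

theorem sum_antidiagonal_delay_mul {R : Type*} [NonUnitalNonAssocSemiring R] (f g : ℕ → R)
    (n : ℕ) :
    ∑ ij ∈ antidiagonal n, delay f ij.1 * g ij.2 =
      ∑ ij ∈ antidiagonal n, f ij.1 * delay g ij.2 := by
  cases n with
  | zero => simp [delay]
  | succ n =>
    rw [Nat.sum_antidiagonal_succ, Nat.sum_antidiagonal_succ']
    simp only [delay, zero_mul, mul_zero]

theorem sum_antidiagonal_ite_mul {R : Type*} [NonUnitalNonAssocSemiring R] (c : R) (g : ℕ → R)
    (n : ℕ) : ∑ ij ∈ antidiagonal n, (if ij.1 = 0 then c else 0) * g ij.2 = c * g n := by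
  cases n <;> simp [Nat.antidiagonal_succ]

theorem hasDerivAt_sum_antidiagonal_mul {f g : ℕ → ℝ → ℝ} {b : ℕ → ℝ} {a x : ℝ}
    (hf : ∀ i, HasDerivAt (f i) (a * delay (f · x) i + b i) x)
    (hg : ∀ j, HasDerivAt (g j) (-(a * delay (g · x) j)) x) (n : ℕ) :
    HasDerivAt (fun y => ∑ ij ∈ antidiagonal n, f ij.1 y * g ij.2 y)
      (∑ ij ∈ antidiagonal n, b ij.1 * g ij.2 x) x := by
  refine (HasDerivAt.fun_sum fun ij _ => (hf ij.1).mul (hg ij.2)).congr_deriv ?_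
  have hcancel := sum_antidiagonal_delay_mul (f · x) (g · x) n
  rw [← sub_eq_zero, ← sum_sub_distrib] at hcancel
  rw [← add_zero (∑ ij ∈ antidiagonal n, b ij.1 * g ij.2 x), ← mul_zero a, ← hcancel,
    mul_sum, ← sum_add_distrib]
  refine sum_congr rfl fun ij _ => ?_
  ring

theorem tendsto_sum_antidiagonal_mul {α : Type*} {F : Filter α} {f g : ℕ → α → ℝ} {l : ℕ → ℝ}
    (hf : ∀ i, Tendsto (f i) F (𝓝 (l i)))
    (hg : ∀ j, Tendsto (g j) F (𝓝 (if j = 0 then 1 else 0))) (n : ℕ) :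
    Tendsto (fun x => ∑ ij ∈ antidiagonal n, f ij.1 x * g ij.2 x) F (𝓝 (l n)) := by
  have hsum : ∑ ij ∈ antidiagonal n, l ij.1 * (if ij.2 = 0 then 1 else 0) = l n := by
    cases n <;> simp [Nat.antidiagonal_succ']
  rw [← hsum]
  exact tendsto_finsetSum _ fun ij _ => (hf ij.1).mul (hg ij.2)

/-- The divided power `u ^ n / n!`. -/
noncomputable def dividedPow (n : ℕ) (u : ℝ) : ℝ := u ^ n / n.factorial

theorem dividedPow_zero_left (u : ℝ) : dividedPow 0 u = 1 := by simp [dividedPow]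

theorem dividedPow_zero_right (n : ℕ) : dividedPow n 0 = if n = 0 then 1 else 0 := by
  cases n <;> simp [dividedPow]

theorem continuous_dividedPow (n : ℕ) : Continuous (dividedPow n) := by
  unfold dividedPow
  fun_prop

theorem hasDerivAt_dividedPow_comp {u : ℝ → ℝ} {u' x : ℝ} (hu : HasDerivAt u u' x) (n : ℕ) :
    HasDerivAt (fun y => dividedPow n (u y)) (u' * delay (fun k => dividedPow k (u x)) n) x := by
  cases n with
  | zero => simpa [dividedPow, delay] using hasDerivAt_const x (1 : ℝ)
  | succ n =>
    refine ((hu.fun_pow (n + 1)).div_const ((n + 1).factorial : ℝ)).congr_deriv ?_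
    have hfac : (n.factorial : ℝ) ≠ 0 := by positivity
    rw [delay, dividedPow, Nat.factorial_succ, Nat.add_sub_cancel]
    push_cast
    field_simp

/-- The divided power `(-log t) ^ s / s!`. -/
noncomputable def logPow (s : ℕ) (t : ℝ) : ℝ := dividedPow s (-Real.log t)

theorem logPow_nonneg {t : ℝ} (h0 : 0 ≤ t) (h1 : t ≤ 1) (s : ℕ) : 0 ≤ logPow s t :=
  div_nonneg (pow_nonneg (neg_nonneg.2 (Real.log_nonpos h0 h1)) s) (Nat.cast_nonneg _)

theorem hasDerivAt_logPow {t : ℝ} (ht : t ≠ 0) (s : ℕ) :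
    HasDerivAt (logPow s) (-(t⁻¹ * delay (logPow · t) s)) t :=
  (hasDerivAt_dividedPow_comp (Real.hasDerivAt_log ht).neg s).congr_deriv (neg_mul _ _)

theorem tendsto_logPow_one (s : ℕ) :
    Tendsto (logPow s) (𝓝[<] 1) (𝓝 (if s = 0 then 1 else 0)) := by
  rw [← dividedPow_zero_right, ← neg_zero, ← Real.log_one]
  exact (hasDerivAt_logPow one_ne_zero s).continuousAt.mono_left nhdsWithin_le_nhds

theorem logPow_le {t : ℝ} (h0 : 0 < t) (h1 : t ≤ 1) (s : ℕ) :
    logPow s t ≤ (2 * (s + 1) : ℝ) ^ s * t ^ (-(1 / 2) : ℝ) := by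
  have hlog : -Real.log t ≤ 2 * (s + 1) * t ^ (-(1 / (2 * (s + 1))) : ℝ) := by
    have h := Real.log_le_rpow_div (inv_nonneg.2 h0.le)
      (show (0 : ℝ) < 1 / (2 * (s + 1)) by positivity)
    rwa [Real.log_inv, Real.inv_rpow h0.le, ← Real.rpow_neg h0.le, div_div_eq_mul_div, div_one,
      mul_comm] at h
  have hneg : 0 ≤ -Real.log t := neg_nonneg.2 (Real.log_nonpos h0.le h1)
  calc logPow s t ≤ (-Real.log t) ^ s :=
        div_le_self (by positivity) (by exact_mod_cast s.factorial_pos)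
    _ ≤ (2 * (s + 1) * t ^ (-(1 / (2 * (s + 1))) : ℝ)) ^ s := by gcongr
    _ = (2 * (s + 1)) ^ s * t ^ (-(1 / (2 * (s + 1))) * s : ℝ) := by
        rw [mul_pow, Real.rpow_mul h0.le, Real.rpow_natCast]
    _ ≤ (2 * (s + 1)) ^ s * t ^ (-(1 / 2) : ℝ) := by
        refine mul_le_mul_of_nonneg_left
          (Real.rpow_le_rpow_of_exponent_ge h0 h1 ?_) (by positivity)
        rw [neg_mul, neg_le_neg_iff, one_div_mul_eq_div,
          div_le_div_iff₀ (by positivity) (by positivity)]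
        linarith

theorem intervalIntegrable_logPow (s : ℕ) :
    IntervalIntegrable (logPow s) MeasureTheory.volume 0 1 := by
  have hmeas : Measurable (logPow s) := (continuous_dividedPow s).measurable.comp (by fun_prop)
  refine ((intervalIntegral.intervalIntegrable_rpow' (r := -(1 / 2)) (by norm_num)).const_mul
    ((2 * (s + 1) : ℝ) ^ s)).mono_fun' hmeas.aestronglyMeasurable ?_
  refine (MeasureTheory.ae_restrict_iff' measurableSet_uIoc).2 (Eventually.of_forall fun t ht => ?_)
  rw [Set.uIoc_of_le zero_le_one] at ht
  simpa only [Real.norm_of_nonneg (logPow_nonneg ht.1.le ht.2 s)] using logPow_le ht.1 ht.2 s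

theorem intervalIntegrable_mul_logPow {g : ℝ → ℝ} (hg : ContinuousOn g (Set.Icc 0 1)) (s : ℕ) :
    IntervalIntegrable (fun t => g t * logPow s t) MeasureTheory.volume 0 1 :=
  (intervalIntegrable_logPow s).continuousOn_mul (by rwa [Set.uIcc_of_le zero_le_one])

theorem tendsto_mul_logPow_zero (s : ℕ) :
    Tendsto (fun t => t * logPow s t) (𝓝[>] 0) (𝓝 0) := by
  have hsqrt : Tendsto (fun t : ℝ => (2 * (s + 1) : ℝ) ^ s * t ^ (1 / 2 : ℝ)) (𝓝[>] 0) (𝓝 0) := by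
    have h := ((Real.continuousAt_rpow_const 0 (1 / 2) (Or.inr (by norm_num))).tendsto.const_mul
      ((2 * (s + 1) : ℝ) ^ s)).mono_left (nhdsWithin_le_nhds (s := Set.Ioi 0))
    rwa [Real.zero_rpow (by norm_num), mul_zero] at h
  refine squeeze_zero' ?_ ?_ hsqrt <;> filter_upwards [Ioo_mem_nhdsGT one_pos] with t ht
  · exact mul_nonneg ht.1.le (logPow_nonneg ht.1.le ht.2.le s)
  · calc t * logPow s t ≤ t * ((2 * (s + 1) : ℝ) ^ s * t ^ (-(1 / 2) : ℝ)) :=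
          mul_le_mul_of_nonneg_left (logPow_le ht.1 ht.2.le s) ht.1.le
      _ = (2 * (s + 1) : ℝ) ^ s * (t ^ (1 : ℝ) * t ^ (-(1 / 2) : ℝ)) := by rw [Real.rpow_one]; ring
      _ = (2 * (s + 1) : ℝ) ^ s * t ^ (1 / 2 : ℝ) := by rw [← Real.rpow_add ht.1]; norm_num

theorem integral_mul_logPow_succ {g g' h : ℝ → ℝ} (hgh : ∀ t ∈ Set.Icc 0 1, g t = t * h t)
    (hg : ∀ t ∈ Set.Icc 0 1, HasDerivAt g (g' t) t) (hg' : ContinuousOn g' (Set.Icc 0 1))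
    (hh : ContinuousOn h (Set.Icc 0 1)) (s : ℕ) :
    ∫ t in (0 : ℝ)..1, g' t * logPow (s + 1) t = ∫ t in (0 : ℝ)..1, h t * logPow s t := by
  have hint' := intervalIntegrable_mul_logPow hg' (s + 1)
  have hint := intervalIntegrable_mul_logPow hh s
  rw [← sub_eq_zero, ← intervalIntegral.integral_sub hint' hint]
  refine (intervalIntegral.integral_eq_sub_of_hasDerivAt_of_tendsto one_pos
    (f := fun t => g t * logPow (s + 1) t) (fun t ht => ?_) (hint'.sub hint) ?_ ?_).trans
    (sub_zero 0)
  · refine ((hg t (Set.Ioo_subset_Icc_self ht)).mul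
      (hasDerivAt_logPow ht.1.ne' (s + 1))).congr_deriv ?_
    rw [hgh t (Set.Ioo_subset_Icc_self ht), delay]
    field [ht.1.ne']
  · have hh0 : Tendsto h (𝓝[>] 0) (𝓝 (h 0)) := (hh 0 (by simp)).mono_left
      (nhdsWithin_le_of_mem (mem_of_superset (Ioo_mem_nhdsGT one_pos) Set.Ioo_subset_Icc_self))
    have hlim := hh0.mul (tendsto_mul_logPow_zero (s + 1))
    rw [mul_zero] at hlim
    refine hlim.congr' ?_
    filter_upwards [Ioo_mem_nhdsGT one_pos] with t ht
    rw [hgh t (Set.Ioo_subset_Icc_self ht)]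
    ring
  · have hlim := ((hg 1 (by simp)).continuousAt.tendsto.mono_left nhdsWithin_le_nhds).mul
      (tendsto_logPow_one (s + 1))
    rwa [if_neg s.succ_ne_zero, mul_zero] at hlim

theorem integral_pow_mul_logPow (n s : ℕ) :
    ∫ t in (0 : ℝ)..1, t ^ n * logPow s t = 1 / ((n : ℝ) + 1) ^ (s + 1) := by
  induction s with
  | zero => simp [logPow, dividedPow_zero_left]
  | succ s ih =>
    have hparts := integral_mul_logPow_succ (g := fun t => t ^ (n + 1) / ((n : ℝ) + 1))
      (h := fun t => t ^ n / ((n : ℝ) + 1)) (g' := fun t => t ^ n) (fun t _ => by ring)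
      (fun t _ => ((hasDerivAt_pow (n + 1) t).div_const _).congr_deriv ?_)
      (by fun_prop) (by fun_prop) s
    · rw [hparts]
      simp only [div_mul_eq_mul_div, intervalIntegral.integral_div, ih]
      rw [pow_succ _ (s + 1), ← div_div]
    · rw [Nat.add_sub_cancel]
      push_cast
      field_simp

theorem abs_integral_sub_altZetaPartialSum_le (s N : ℕ) :
    |(∫ t in (0 : ℝ)..1, 1 / (1 + t) * logPow s t) - altZetaPartialSum (s + 1) N| ≤
      1 / ((N : ℝ) + 1) := by
  have hpartial : altZetaPartialSum (s + 1) N =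
      ∫ t in (0 : ℝ)..1, (∑ n ∈ range N, (-t) ^ n) * logPow s t := by
    simp only [sum_mul]
    rw [intervalIntegral.integral_finsetSum fun n _ =>
      intervalIntegrable_mul_logPow (by fun_prop) s, altZetaPartialSum, ← zero_add N,
      sum_Icc_one_add_of_eq_zero (by simp)]
    simp only [zero_add]
    refine sum_congr rfl fun n _ => ?_
    have hneg : ∀ t : ℝ, (-t) ^ n * logPow s t = (-1) ^ n * (t ^ n * logPow s t) := fun t => by
      rw [neg_pow, mul_assoc]
    simp only [hneg, intervalIntegral.integral_const_mul, integral_pow_mul_logPow]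
    rw [Nat.add_sub_cancel_left, mul_one_div, Nat.cast_add, Nat.cast_one, add_comm (1 : ℝ)]
  have hinv : ContinuousOn (fun t : ℝ => 1 / (1 + t)) (Set.Icc 0 1) :=
    continuousOn_const.div (by fun_prop) fun t ht => by linarith [ht.1]
  rw [hpartial, ← intervalIntegral.integral_sub (intervalIntegrable_mul_logPow hinv s)
    (intervalIntegrable_mul_logPow (by fun_prop) s), ← Real.norm_eq_abs]
  calc _ ≤ ∫ t in (0 : ℝ)..1, t ^ N * logPow s t := by
        refine intervalIntegral.norm_integral_le_of_norm_le zero_le_one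
          (Eventually.of_forall fun t ht => ?_) (intervalIntegrable_mul_logPow (by fun_prop) s)
        have hpos : 0 < 1 + t := by linarith [ht.1]
        have hgeom : 1 / (1 + t) - ∑ n ∈ range N, (-t) ^ n = (-t) ^ N / (1 + t) := by
          have h := mul_neg_geom_sum (-t) N
          rw [sub_neg_eq_add] at h
          field_simp
          linarith
        rw [← sub_mul, hgeom, norm_mul, Real.norm_of_nonneg (logPow_nonneg ht.1.le ht.2 s),
          norm_div, norm_pow, norm_neg, Real.norm_of_nonneg ht.1.le, Real.norm_of_nonneg hpos.le]
        exact mul_le_mul_of_nonneg_right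
          (div_le_self (pow_nonneg ht.1.le _) (by linarith [ht.1])) (logPow_nonneg ht.1.le ht.2 s)
    _ = 1 / ((N : ℝ) + 1) ^ (s + 1) := integral_pow_mul_logPow N s
    _ ≤ 1 / ((N : ℝ) + 1) := by
        gcongr
        exact le_self_pow₀ (by linarith [N.cast_nonneg (α := ℝ)]) s.succ_ne_zero

theorem integral_one_div_one_add_mul_logPow (s : ℕ) :
    ∫ t in (0 : ℝ)..1, 1 / (1 + t) * logPow s t = altZeta (s + 1) := by
  refine tendsto_nhds_unique ?_ (tendsto_altZetaPartialSum s.succ_pos)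
  rw [tendsto_iff_norm_sub_tendsto_zero]
  refine squeeze_zero (fun _ => norm_nonneg _) (fun N => ?_)
    tendsto_one_div_add_atTop_nhds_zero_nat
  rw [norm_sub_rev]
  exact abs_integral_sub_altZetaPartialSum_le s N

end LogarithmicIntegrals

section CayleyMoments

open Finset

/-- The involution `t ↦ (1 - t) / (1 + t)` of the unit interval. -/
noncomputable def cayley (t : ℝ) : ℝ := (1 - t) / (1 + t)

theorem cayley_zero : cayley 0 = 1 := by simp [cayley]

theorem cayley_one : cayley 1 = 0 := by simp [cayley]

theorem cayley_mem_Ico {t : ℝ} (ht : t ∈ Set.Ioc 0 1) : cayley t ∈ Set.Ico 0 1 :=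
  ⟨div_nonneg (by linarith [ht.2]) (by linarith [ht.1]),
    (div_lt_one (by linarith [ht.1])).2 (by linarith [ht.1])⟩

theorem hasDerivAt_cayley {t : ℝ} (ht : 0 ≤ t) :
    HasDerivAt cayley (-(2 / (1 + t) ^ 2)) t := by
  have hne : 1 + t ≠ 0 := by positivity
  refine (((hasDerivAt_id t).const_sub 1).div ((hasDerivAt_id t).const_add 1) hne).congr_deriv ?_
  simp only [id]
  field

theorem continuousOn_cayley : ContinuousOn cayley (Set.Icc 0 1) := fun _ ht =>
  (hasDerivAt_cayley ht.1).continuousAt.continuousWithinAt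

theorem continuousOn_two_div_one_add_pow (k : ℕ) :
    ContinuousOn (fun t : ℝ => 2 / (1 + t) ^ k) (Set.Icc 0 1) :=
  continuousOn_const.div (by fun_prop) fun t ht => by have := ht.1; positivity

theorem one_sub_cayley_pow (n : ℕ) {t : ℝ} (ht : 0 ≤ t) :
    1 - cayley t ^ n = t * (2 / (1 + t) * ∑ i ∈ range n, cayley t ^ i) := by
  rw [← mul_neg_geom_sum, ← mul_assoc]
  congr 1
  unfold cayley
  field

theorem hasDerivAt_one_sub_cayley_pow (n : ℕ) {t : ℝ} (ht : 0 ≤ t) :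
    HasDerivAt (fun t => 1 - cayley t ^ n) (n * cayley t ^ (n - 1) * (2 / (1 + t) ^ 2)) t :=
  (((hasDerivAt_cayley ht).pow n).const_sub 1).congr_deriv (by ring)

theorem continuousOn_deriv_one_sub_cayley_pow (n : ℕ) :
    ContinuousOn (fun t => n * cayley t ^ (n - 1) * (2 / (1 + t) ^ 2)) (Set.Icc 0 1) :=
  (continuousOn_const.mul (continuousOn_cayley.pow _)).mul (continuousOn_two_div_one_add_pow 2)

theorem continuousOn_geom_sum_cayley (n : ℕ) :
    ContinuousOn (fun t => 2 / (1 + t) * ∑ i ∈ range n, cayley t ^ i) (Set.Icc 0 1) := by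
  have hdiv := continuousOn_two_div_one_add_pow 1
  simp only [pow_one] at hdiv
  exact hdiv.mul (continuousOn_finsetSum _ fun i _ => continuousOn_cayley.pow i)

/-- `n ∫_0^1 x^{n-1} (log ((1+x)/(1-x)))^s / s! dx`, written in the variable `t = cayley x`. -/
noncomputable def cayleyMoment (s n : ℕ) : ℝ :=
  ∫ t in (0 : ℝ)..1, n * cayley t ^ (n - 1) * (2 / (1 + t) ^ 2) * logPow s t

theorem cayleyMoment_div (s n : ℕ) :
    cayleyMoment s (n + 1) / ((n : ℝ) + 1) =
      ∫ t in (0 : ℝ)..1, cayley t ^ n * (2 / (1 + t) ^ 2 * logPow s t) := by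
  rw [cayleyMoment, ← intervalIntegral.integral_div]
  congr 1 with t
  rw [Nat.add_sub_cancel]
  push_cast
  field_simp

theorem cayleyMoment_zero_right (s : ℕ) : cayleyMoment s 0 = 0 := by simp [cayleyMoment]

theorem cayleyMoment_zero_left (n : ℕ) : cayleyMoment 0 (n + 1) = 1 := by
  simp only [cayleyMoment, logPow, dividedPow_zero_left, mul_one]
  rw [intervalIntegral.integral_eq_sub_of_hasDerivAt (fun t ht =>
    hasDerivAt_one_sub_cayley_pow (n + 1) (Set.uIcc_of_le (zero_le_one' ℝ) ▸ ht).1)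
    ((continuousOn_deriv_one_sub_cayley_pow (n + 1)).intervalIntegrable_of_Icc zero_le_one)]
  simp [cayley_zero, cayley_one]

theorem cayleyMoment_succ_left (s n : ℕ) :
    cayleyMoment (s + 1) n =
      ∫ t in (0 : ℝ)..1, 2 / (1 + t) * (∑ i ∈ range n, cayley t ^ i) * logPow s t :=
  integral_mul_logPow_succ (fun _ ht => one_sub_cayley_pow n ht.1)
    (fun _ ht => hasDerivAt_one_sub_cayley_pow n ht.1) (continuousOn_deriv_one_sub_cayley_pow n)
    (continuousOn_geom_sum_cayley n) s

theorem cayleyMoment_succ_add_two (s n : ℕ) :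
    cayleyMoment (s + 1) (n + 2) =
      cayleyMoment (s + 1) n + 2 / ((n : ℝ) + 1) * cayleyMoment s (n + 1) := by
  rw [div_mul_eq_mul_div, mul_div_assoc, cayleyMoment_div, cayleyMoment_succ_left,
    cayleyMoment_succ_left, ← intervalIntegral.integral_const_mul,
    ← intervalIntegral.integral_add
      (intervalIntegrable_mul_logPow (continuousOn_geom_sum_cayley n) s)]
  · refine intervalIntegral.integral_congr fun t ht => ?_
    rw [Set.uIcc_of_le zero_le_one] at ht
    have hne : 1 + t ≠ 0 := by linarith [ht.1]
    have hweight : 2 / (1 + t) * (1 + cayley t) = 2 * (2 / (1 + t) ^ 2) := by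
      unfold cayley
      field
    simp only [sum_range_succ, pow_succ]
    linear_combination cayley t ^ n * logPow s t * hweight
  · simp only [← mul_assoc]
    exact intervalIntegrable_mul_logPow ((continuousOn_const.mul (continuousOn_cayley.pow n)).mul
      (continuousOn_two_div_one_add_pow 2)) s

theorem cayleyMoment_one (s : ℕ) : cayleyMoment s 1 = 2 * altZeta s := by
  cases s with
  | zero => simp [cayleyMoment_zero_left 0, altZeta]
  | succ s =>
    rw [cayleyMoment_succ_left, ← integral_one_div_one_add_mul_logPow,
      ← intervalIntegral.integral_const_mul]
    congr 1 with t
    rw [sum_range_one, pow_zero]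
    ring

theorem powerGrowth_cayleyMoment {a : ℝ} (ha : 0 < a) (ha1 : a ≤ 1) (s r : ℕ) :
    PowerGrowth a fun i => cayleyMoment s (r + 2 * i + 1) := by
  induction s generalizing r with
  | zero => simpa only [cayleyMoment_zero_left] using PowerGrowth.const ha.le 1
  | succ s ih =>
    have hstep := (((ih (r + 1)).div_pow (c := (r : ℝ) + 2)
      (by linarith [r.cast_nonneg (α := ℝ)]) le_rfl).const_mul 2).isBigO
    refine PowerGrowth.of_isBigO_sub ha ha1 (hstep.congr_left fun i => ?_)
    rw [show r + 2 * (i + 1) + 1 = r + 2 * i + 1 + 2 by ring, cayleyMoment_succ_add_two,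
      show r + 2 * i + 1 + 1 = r + 1 + 2 * i + 1 by ring]
    push_cast
    ring

/-- The generating series over the depths of a fixed parity `ε` of the sums `T_n({1}_{2p + ε})`. -/
noncomputable def onesTSeries (ε n : ℕ) : PowerSeries ℝ :=
  PowerSeries.mk fun p => onesTSum (2 * p + ε) n

/-- The generating series over the exponents of a fixed parity `ε` of the moments. -/
noncomputable def momentSeries (ε n : ℕ) : PowerSeries ℝ :=
  PowerSeries.mk fun p => cayleyMoment (2 * p + ε) n

theorem onesTSeries_one_succ (n : ℕ) :
    onesTSeries 1 (n + 1) =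
      onesTSeries 1 n + (2 / (2 * (n : ℝ) + 1)) • onesTSeries 0 (n + 1) := by
  ext p
  simpa [onesTSeries] using onesTSum_succ_add (2 * p) n

theorem onesTSeries_zero_add_two (n : ℕ) :
    onesTSeries 0 (n + 2) = onesTSeries 0 (n + 1) +
      (2 / (2 * (n : ℝ) + 2)) • (PowerSeries.X * onesTSeries 1 (n + 1)) := by
  ext p
  cases p with
  | zero => simp [onesTSeries, onesTSum_zero]
  | succ p =>
    have h := onesTSum_succ_add (2 * p + 1) n
    rw [show (2 * p + 1) % 2 = 1 by omega, add_assoc _ (1 : ℝ)] at h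
    simpa [onesTSeries, PowerSeries.coeff_succ_X_mul, mul_add, one_add_one_eq_two] using h

theorem momentSeries_one_add_two (n : ℕ) :
    momentSeries 1 (n + 2) =
      momentSeries 1 n + (2 / ((n : ℝ) + 1)) • momentSeries 0 (n + 1) := by
  ext p
  simpa [momentSeries] using cayleyMoment_succ_add_two (2 * p) n

theorem momentSeries_zero_add_three (n : ℕ) :
    momentSeries 0 (n + 3) = momentSeries 0 (n + 1) +
      (2 / ((n : ℝ) + 2)) • (PowerSeries.X * momentSeries 1 (n + 2)) := by
  ext p
  cases p with
  | zero => simp [momentSeries, cayleyMoment_zero_left]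
  | succ p =>
    have h := cayleyMoment_succ_add_two (2 * p + 1) (n + 1)
    push_cast at h
    rw [add_assoc _ (1 : ℝ)] at h
    simpa [momentSeries, PowerSeries.coeff_succ_X_mul, mul_add, one_add_one_eq_two] using h

theorem momentSeries_eq_mul_onesTSeries (n : ℕ) :
    momentSeries 1 (2 * n) = evenAltZetaSeries * onesTSeries 1 n ∧
      momentSeries 0 (2 * n + 1) = evenAltZetaSeries * onesTSeries 0 (n + 1) := by
  induction n with
  | zero =>
    have hodd : onesTSeries 1 0 = 0 := by
      ext p
      simpa [onesTSeries] using onesTSum_succ_mod_two (2 * p)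
    have heven : onesTSeries 0 1 = 1 := by
      ext p
      cases p with
      | zero => simp [onesTSeries, onesTSum_zero]
      | succ p => simpa [onesTSeries, mul_add] using onesTSum_succ_mod_two (2 * p + 1)
    rw [zero_add, hodd, heven, mul_zero, mul_one]
    constructor <;> ext p
    · simp [momentSeries, cayleyMoment_zero_right]
    · simp [momentSeries, cayleyMoment_one, evenAltZetaSeries]
  | succ n ih =>
    have hodd : momentSeries 1 (2 * n + 2) = evenAltZetaSeries * onesTSeries 1 (n + 1) := by
      rw [momentSeries_one_add_two, ih.1, ih.2, onesTSeries_one_succ, mul_add, mul_smul_comm]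
      push_cast
      rfl
    refine ⟨hodd, ?_⟩
    rw [show 2 * (n + 1) + 1 = 2 * n + 3 by ring, momentSeries_zero_add_three, hodd, ih.2,
      onesTSeries_zero_add_two, mul_add, mul_smul_comm, mul_left_comm]
    push_cast
    rfl

theorem onesTSum_eq_sum_coeffZ_mul_cayleyMoment (p n : ℕ) :
    onesTSum (2 * p + 1) n =
      ∑ j ∈ range (p + 1), coeffZ (j + 1) (p + 1) * cayleyMoment (2 * j + 1) (2 * n) := by
  have hinv : onesTSeries 1 n = momentSeries 1 (2 * n) * evenAltZetaSeries⁻¹ := by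
    rw [(momentSeries_eq_mul_onesTSeries n).1, mul_right_comm,
      PowerSeries.mul_inv_cancel _ (by simp [constantCoeff_evenAltZetaSeries]), one_mul]
  have hcoeff := congrArg (PowerSeries.coeff p) hinv
  rw [onesTSeries, PowerSeries.coeff_mk, PowerSeries.coeff_mul,
    Nat.sum_antidiagonal_eq_sum_range_succ fun j d =>
      PowerSeries.coeff j _ * PowerSeries.coeff d _] at hcoeff
  rw [hcoeff]
  refine sum_congr rfl fun j hj => ?_
  rw [mul_comm, momentSeries, PowerSeries.coeff_mk, ← coeffZ_add (j + 1),
    show j + 1 + (p - j) = p + 1 by have := mem_range.1 hj; omega]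

end CayleyMoments

section MTPolylogarithms

open Finset

theorem hasSum_sum_range_mul_pow {f : ℕ → ℝ} {y l : ℝ} (hy : |y| < 1)
    (hf : HasSum (fun i => f i * y ^ i) l) :
    HasSum (fun i => (∑ j ∈ range (i + 1), f j) * y ^ i) (l / (1 - y)) := by
  rw [← Real.norm_eq_abs] at hy
  have hcauchy := hasSum_sum_range_mul_of_summable_norm hf.summable.norm
    (summable_norm_geometric_of_norm_lt_one hy)
  rw [hf.tsum_eq, tsum_geometric_of_norm_lt_one hy, ← div_eq_mul_inv] at hcauchy
  refine hcauchy.congr_fun fun i => ?_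
  rw [sum_mul]
  refine sum_congr rfl fun j hj => ?_
  rw [mul_assoc, ← pow_add, Nat.add_sub_cancel' (by simpa [Nat.lt_succ_iff] using hj)]

/-- The sum over all indices `k` of depth `r` and weight `r + s` of the polylogarithms
`2 ^ r * ∑ (-1) ^ i * x ^ (r + 2 * i) / ((2 n_1 - 1) ^ k_1 ⋯ (2 n_r - r) ^ k_r)`, where
`n_r = r + i`; the sign is normalised so that the leading coefficient is positive. -/
noncomputable def mtPolylog : ℕ → ℕ → ℝ → ℝ
  | 0, s, _ => if s = 0 then 1 else 0
  | r + 1, s, x => ∑' i, (-1) ^ i * indexMTTerm r s i * x ^ (r + 1 + 2 * i)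

theorem mtPolylog_succ_zero (r s : ℕ) : mtPolylog (r + 1) s 0 = 0 := by
  simp [mtPolylog]

theorem abs_neg_sq_lt_one {x : ℝ} (hx : |x| < 1) : |-x ^ 2| < 1 := by
  simpa using hx

theorem hasSum_indexMTTerm (r s : ℕ) {x : ℝ} (hx : |x| < 1) :
    HasSum (fun i => (-1) ^ i * indexMTTerm r s i * x ^ (r + 1 + 2 * i))
      (mtPolylog (r + 1) s x) := by
  refine Summable.hasSum (((powerGrowth_indexMTTerm one_pos le_rfl r s).summable_mul_pow (by simp)
    (abs_neg_sq_lt_one hx)).mul_left (x ^ (r + 1)) |>.congr fun i => ?_)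
  rw [neg_pow, pow_add x (r + 1), pow_mul]
  ring

theorem hasSum_indexMTSum (r s : ℕ) {x : ℝ} (hx : |x| < 1) :
    HasSum (fun i => (-1) ^ i * indexMTSum r s i * x ^ (r + 2 * i))
      (mtPolylog r s x / (1 + x ^ 2)) := by
  have hy := abs_neg_sq_lt_one hx
  rw [← sub_neg_eq_add]
  cases r with
  | zero =>
    refine ((hasSum_geometric_of_abs_lt_one hy).mul_left (if s = 0 then 1 else 0)).congr_fun
      fun i => ?_
    rw [indexMTSum_zero, zero_add, pow_mul, neg_pow]
    ring
  | succ r =>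
    have hterm : HasSum (fun i => x ^ (r + 1) * indexMTTerm r s i * (-x ^ 2) ^ i)
        (mtPolylog (r + 1) s x) := by
      refine (hasSum_indexMTTerm r s hx).congr_fun fun i => ?_
      rw [neg_pow, pow_add x (r + 1), pow_mul]
      ring
    refine (hasSum_sum_range_mul_pow hy hterm).congr_fun fun i => ?_
    rw [indexMTSum_succ, ← mul_sum, neg_pow, pow_add x (r + 1), pow_mul]
    ring

theorem hasSum_indexMTTerm_mul (r s : ℕ) {x : ℝ} (hx : |x| < 1) (h0 : x ≠ 0 ∨ s = 0) :
    HasSum (fun i => (-1) ^ i * indexMTTerm r s i * ((r : ℝ) + 1 + 2 * i) * x ^ (r + 2 * i))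
      (x⁻¹ * delay (mtPolylog (r + 1) · x) s + 2 / (1 + x ^ 2) * mtPolylog r s x) := by
  have hdelay : HasSum (fun i => (-1) ^ i * delay (indexMTTerm r · i) s * x ^ (r + 2 * i))
      (x⁻¹ * delay (mtPolylog (r + 1) · x) s) := by
    cases s with
    | zero => simp [delay]
    | succ s =>
      have hx0 : x ≠ 0 := by simpa using h0
      refine ((hasSum_indexMTTerm r s hx).mul_left x⁻¹).congr_fun fun i => ?_
      simp only [delay]
      field_simp
      ring
  convert! hdelay.add ((hasSum_indexMTSum r s hx).mul_left 2) using 1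
  · funext i
    rw [mul_assoc ((-1 : ℝ) ^ i), indexMTTerm_mul]
    ring
  · ring

theorem hasDerivAt_mtPolylog_tsum (r s : ℕ) {x : ℝ} (hx : |x| < 1) :
    HasDerivAt (mtPolylog (r + 1) s)
      (∑' i : ℕ, (-1) ^ i * indexMTTerm r s i * ((r : ℝ) + 1 + 2 * i) * x ^ (r + 2 * i)) x := by
  obtain ⟨ρ, hxρ, hρ⟩ := exists_between hx
  have hρ0 : 0 < ρ := (abs_nonneg x).trans_lt hxρ
  refine hasDerivAt_tsum_of_isPreconnected (y₀ := 0) (t := Metric.ball 0 ρ)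
    (g := fun i x => (-1) ^ i * indexMTTerm r s i * x ^ (r + 1 + 2 * i))
    (g' := fun i x => (-1) ^ i * indexMTTerm r s i * ((r : ℝ) + 1 + 2 * i) * x ^ (r + 2 * i))
    (hasSum_indexMTTerm_mul r s (by rwa [abs_of_pos hρ0]) (.inl hρ0.ne')).summable.abs
    Metric.isOpen_ball (convex_ball _ _).isPreconnected (fun i y _ => ?_) (fun i y hy => ?_)
    (Metric.mem_ball_self hρ0) (hasSum_indexMTTerm r s (by simp)).summable (by simpa using hxρ)
  · refine ((hasDerivAt_pow (r + 1 + 2 * i) y).const_mul _).congr_deriv ?_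
    rw [show r + 1 + 2 * i - 1 = r + 2 * i by omega]
    push_cast
    ring
  · rw [mem_ball_zero_iff, Real.norm_eq_abs] at hy
    rw [Real.norm_eq_abs, abs_mul, abs_mul _ (ρ ^ _), abs_pow, abs_pow, abs_of_pos hρ0]
    gcongr

theorem hasDerivAt_mtPolylog (r s : ℕ) {x : ℝ} (hx : |x| < 1) (h0 : x ≠ 0 ∨ s = 0) :
    HasDerivAt (mtPolylog (r + 1) s)
      (x⁻¹ * delay (mtPolylog (r + 1) · x) s + 2 / (1 + x ^ 2) * mtPolylog r s x) x :=
  (hasSum_indexMTTerm_mul r s hx h0).tsum_eq ▸ hasDerivAt_mtPolylog_tsum r s hx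

theorem mtPolylog_zero_right (r : ℕ) {x : ℝ} (hx : x ∈ Set.Ico 0 1) :
    mtPolylog r 0 x = dividedPow r (2 * Real.arctan x) := by
  induction r generalizing x with
  | zero => simp [mtPolylog, dividedPow]
  | succ r ih =>
    have hderiv : ∀ y ∈ Set.Icc 0 x, HasDerivAt
        (fun y => mtPolylog (r + 1) 0 y - dividedPow (r + 1) (2 * Real.arctan y)) 0 y := by
      intro y hy
      have hy1 : y ∈ Set.Ico 0 1 := ⟨hy.1, hy.2.trans_lt hx.2⟩
      refine ((hasDerivAt_mtPolylog r 0 (by rw [abs_of_nonneg hy.1]; exact hy1.2) (.inr rfl)).sub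
        (hasDerivAt_dividedPow_comp ((Real.hasDerivAt_arctan y).const_mul 2)
          (r + 1))).congr_deriv ?_
      simp only [delay, ih hy1]
      ring
    have hconst := constant_of_has_deriv_right_zero
      (fun y hy => (hderiv y hy).continuousAt.continuousWithinAt)
      (fun y hy => (hderiv y (Set.Ico_subset_Icc_self hy)).hasDerivWithinAt) x ⟨hx.1, le_rfl⟩
    simpa [mtPolylog_succ_zero, dividedPow_zero_right, sub_eq_zero] using hconst

theorem tendsto_sq_nhdsLT_one : Tendsto (fun x : ℝ => x ^ 2) (𝓝[<] 1) (𝓝[<] 1) := by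
  refine tendsto_nhdsWithin_iff.2
    ⟨by simpa using ((continuous_pow 2).tendsto (1 : ℝ)).mono_left nhdsWithin_le_nhds, ?_⟩
  filter_upwards [Ioo_mem_nhdsLT (zero_lt_one (α := ℝ))] with x hx
  exact pow_lt_one₀ hx.1.le hx.2 two_ne_zero

theorem tendsto_mtPolylog_one (r s : ℕ) :
    Tendsto (mtPolylog (r + 1) s) (𝓝[<] 1) (𝓝 ((-1) ^ (r + 1) * sumW (r + 1 + s) (r + 1))) := by
  have habel := (Real.tendsto_tsum_powerSeries_nhdsWithin_lt
    (tendsto_sum_alternating_indexMTTerm r s)).comp tendsto_sq_nhdsLT_one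
  have hpow : Tendsto (fun x : ℝ => x ^ (r + 1)) (𝓝[<] 1) (𝓝 1) := by
    simpa using ((continuous_pow (r + 1)).tendsto (1 : ℝ)).mono_left nhdsWithin_le_nhds
  rw [← one_mul ((-1) ^ (r + 1) * _)]
  refine (hpow.mul habel).congr fun x => ?_
  simp only [Function.comp_apply, ← tsum_mul_left, mtPolylog, pow_add x (r + 1), pow_mul]
  exact tsum_congr fun i => mul_left_comm _ _ _

theorem tendsto_mtPolylog_mul_logPow (r s b : ℕ) :
    Tendsto (fun x => mtPolylog (r + 1) s x * logPow b x) (𝓝[>] 0) (𝓝 0) := by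
  have hslope := (hasDerivAt_iff_tendsto_slope.1
    (hasDerivAt_mtPolylog_tsum r s (x := 0) (by simp))).mono_left
    (nhdsWithin_mono 0 (s := Set.Ioi 0) fun x hx => ne_of_gt hx)
  have hmul := hslope.mul (tendsto_mul_logPow_zero b)
  rw [mul_zero] at hmul
  refine hmul.congr' ?_
  filter_upwards [self_mem_nhdsWithin] with x (hx : 0 < x)
  rw [slope_def_field, mtPolylog_succ_zero, sub_zero, sub_zero, ← mul_assoc,
    div_mul_cancel₀ _ hx.ne']

/-- The divided powers of `π / 2 - 2 * arctan x`, which vanish at `1` and so annihilate all but the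
intended boundary term in the integration by parts for `sumW`. -/
noncomputable def coarctanPow (k : ℕ) (x : ℝ) : ℝ := dividedPow k (Real.pi / 2 - 2 * Real.arctan x)

theorem hasDerivAt_coarctanPow (k : ℕ) (x : ℝ) :
    HasDerivAt (coarctanPow k) (-(2 / (1 + x ^ 2) * delay (coarctanPow · x) k)) x :=
  (hasDerivAt_dividedPow_comp
    (((Real.hasDerivAt_arctan x).const_mul 2).const_sub (Real.pi / 2)) k).congr_deriv (by
      simp only [coarctanPow]
      ring)

theorem continuous_coarctanPow (k : ℕ) : Continuous (coarctanPow k) :=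
  continuous_iff_continuousAt.2 fun x => (hasDerivAt_coarctanPow k x).continuousAt

theorem coarctanPow_one (k : ℕ) : coarctanPow k 1 = if k = 0 then 1 else 0 := by
  rw [coarctanPow, Real.arctan_one, show Real.pi / 2 - 2 * (Real.pi / 4) = 0 by ring,
    dividedPow_zero_right]

/-- The convolution over `s` of `mtPolylog r` with `logPow`: the logarithms cancel the singular part
`x⁻¹` of the differential equations of the polylogarithms. -/
noncomputable def logConvolution (r s : ℕ) (x : ℝ) : ℝ :=
  ∑ ij ∈ antidiagonal s, mtPolylog r ij.1 x * logPow ij.2 x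

theorem logConvolution_zero (s : ℕ) (x : ℝ) : logConvolution 0 s x = logPow s x := by
  simpa only [logConvolution, mtPolylog, one_mul] using sum_antidiagonal_ite_mul 1 (logPow · x) s

theorem hasDerivAt_logConvolution (r s : ℕ) {x : ℝ} (hx : x ∈ Set.Ioo 0 1) :
    HasDerivAt (logConvolution (r + 1) s) (2 / (1 + x ^ 2) * logConvolution r s x) x := by
  have hx1 : |x| < 1 := by rw [abs_of_pos hx.1]; exact hx.2
  refine (hasDerivAt_sum_antidiagonal_mul
    (fun i => hasDerivAt_mtPolylog r i hx1 (.inl hx.1.ne'))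
    (fun j => hasDerivAt_logPow hx.1.ne' j) s).congr_deriv ?_
  simp only [logConvolution, mul_sum, mul_assoc]

theorem tendsto_logConvolution_zero (r s : ℕ) :
    Tendsto (logConvolution (r + 1) s) (𝓝[>] 0) (𝓝 0) := by
  have hsum := tendsto_finsetSum (antidiagonal s) fun ij _ =>
    tendsto_mtPolylog_mul_logPow r ij.1 ij.2
  rwa [sum_const_zero] at hsum

theorem tendsto_logConvolution_one (r s : ℕ) :
    Tendsto (logConvolution (r + 1) s) (𝓝[<] 1) (𝓝 ((-1) ^ (r + 1) * sumW (r + 1 + s) (r + 1))) :=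
  tendsto_sum_antidiagonal_mul (tendsto_mtPolylog_one r) tendsto_logPow_one s

theorem hasDerivAt_sum_logConvolution_mul (r s : ℕ) {x : ℝ} (hx : x ∈ Set.Ioo 0 1) :
    HasDerivAt (fun y => ∑ ij ∈ antidiagonal r, logConvolution (ij.1 + 1) s y * coarctanPow ij.2 y)
      (2 / (1 + x ^ 2) * coarctanPow r x * logPow s x) x := by
  have hderiv : ∀ i, HasDerivAt (logConvolution (i + 1) s)
      (2 / (1 + x ^ 2) * delay (fun i => logConvolution (i + 1) s x) i +
        if i = 0 then 2 / (1 + x ^ 2) * logPow s x else 0) x := fun i =>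
    (hasDerivAt_logConvolution i s hx).congr_deriv (by
      cases i <;> simp [delay, logConvolution_zero])
  refine (hasDerivAt_sum_antidiagonal_mul hderiv (hasDerivAt_coarctanPow · x) r).congr_deriv ?_
  rw [sum_antidiagonal_ite_mul (2 / (1 + x ^ 2) * logPow s x) (coarctanPow · x) r]
  ring

theorem integral_coarctanPow_mul_logPow (r s : ℕ) :
    ∫ x in (0 : ℝ)..1, 2 / (1 + x ^ 2) * coarctanPow r x * logPow s x =
      (-1) ^ (r + 1) * sumW (r + 1 + s) (r + 1) := by
  have hcont : Continuous fun x => 2 / (1 + x ^ 2) * coarctanPow r x :=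
    (continuous_const.div (by fun_prop) fun x => by positivity).mul (continuous_coarctanPow r)
  have hzero : Tendsto (fun y => ∑ ij ∈ antidiagonal r,
      logConvolution (ij.1 + 1) s y * coarctanPow ij.2 y) (𝓝[>] 0) (𝓝 0) := by
    simpa using tendsto_finsetSum (antidiagonal r) fun ij _ =>
      (tendsto_logConvolution_zero ij.1 s).mul
        (((continuous_coarctanPow ij.2).tendsto 0).mono_left nhdsWithin_le_nhds)
  have hone := tendsto_sum_antidiagonal_mul (fun i => tendsto_logConvolution_one i s) (fun k =>
    coarctanPow_one k ▸ ((continuous_coarctanPow k).tendsto 1).mono_left nhdsWithin_le_nhds) r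
  simpa using intervalIntegral.integral_eq_sub_of_hasDerivAt_of_tendsto one_pos
    (fun x hx => hasDerivAt_sum_logConvolution_mul r s hx)
    (intervalIntegrable_mul_logPow hcont.continuousOn s) hzero hone

end MTPolylogarithms

section AbelSummation

open Finset MeasureTheory

variable {α : Type*} [MeasurableSpace α] {μ : Measure α} {a : ℕ → ℝ} {r : ℕ} {Q : ℝ → ℝ}
  {c w : α → ℝ}

theorem hasSum_integral_pow_mul
    (hsum : ∀ x ∈ Set.Ico 0 1, HasSum (fun i => a i * x ^ (r + 2 * i)) (Q x))
    (hc : AEStronglyMeasurable c μ) (hc01 : ∀ᵐ t ∂μ, c t ∈ Set.Icc 0 1) (hw : Integrable w μ)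
    {z : ℝ} (hz : z ∈ Set.Ico 0 1) :
    HasSum (fun i => a i * z ^ (r + 2 * i) * ∫ t, c t ^ (r + 2 * i) * w t ∂μ)
      (∫ t, Q (z * c t) * w t ∂μ) := by
  simp only [← integral_const_mul]
  refine hasSum_integral_of_dominated_convergence
    (fun i t => |a i * z ^ (r + 2 * i)| * |w t|) (fun i => ?_) (fun i => ?_) ?_ ?_ ?_
  · exact ((hc.pow _).mul hw.aestronglyMeasurable).const_mul _
  · filter_upwards [hc01] with t ht
    rw [Real.norm_eq_abs, abs_mul, abs_mul (c t ^ _)]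
    gcongr
    refine mul_le_of_le_one_left (abs_nonneg _) ?_
    rw [abs_of_nonneg (pow_nonneg ht.1 _)]
    exact pow_le_one₀ ht.1 ht.2
  · exact Eventually.of_forall fun t => (hsum z hz).summable.abs.mul_right _
  · simp only [tsum_mul_right]
    exact hw.abs.const_mul _
  · filter_upwards [hc01] with t ht
    have hzc : z * c t ∈ Set.Ico 0 1 :=
      ⟨mul_nonneg hz.1 ht.1, (mul_le_of_le_one_right hz.1 ht.2).trans_lt hz.2⟩
    refine ((hsum _ hzc).mul_right (w t)).congr_fun fun i => ?_
    rw [mul_pow]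
    ring

theorem tendsto_integral_comp_mul (hQ : Continuous Q)
    (hc : AEStronglyMeasurable c μ) (hc01 : ∀ᵐ t ∂μ, c t ∈ Set.Icc 0 1) (hw : Integrable w μ) :
    Tendsto (fun z => ∫ t, Q (z * c t) * w t ∂μ) (𝓝[<] 1) (𝓝 (∫ t, Q (c t) * w t ∂μ)) := by
  obtain ⟨C, hC⟩ :=
    (isCompact_Icc (a := (0 : ℝ)) (b := 1)).exists_bound_of_continuousOn hQ.continuousOn
  refine tendsto_integral_filter_of_dominated_convergence (fun t => C * |w t|)
    (Eventually.of_forall fun z => ?_) ?_ (hw.abs.const_mul C) (Eventually.of_forall fun t => ?_)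
  · exact (hQ.comp_aestronglyMeasurable (hc.const_mul z)).mul hw.aestronglyMeasurable
  · filter_upwards [Ioo_mem_nhdsLT (zero_lt_one (α := ℝ))] with z hz
    filter_upwards [hc01] with t ht
    rw [norm_mul, Real.norm_eq_abs (w t)]
    exact mul_le_mul_of_nonneg_right
      (hC _ ⟨mul_nonneg hz.1.le ht.1, mul_le_one₀ hz.2.le ht.1 ht.2⟩) (abs_nonneg _)
  · have hcont : Continuous fun z => Q (z * c t) * w t := by fun_prop
    simpa using (hcont.tendsto 1).mono_left (nhdsWithin_le_nhds (s := Set.Iio 1))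

/- The series of `Q` need not converge at `1`, so dominated convergence does not apply directly;
Abel's theorem for the convergent series of integrals takes its place. -/
theorem eq_integral_of_tendsto_sum_mul_integral_pow (hQ : Continuous Q)
    (hsum : ∀ x ∈ Set.Ico 0 1, HasSum (fun i => a i * x ^ (r + 2 * i)) (Q x))
    (hc : AEStronglyMeasurable c μ) (hc01 : ∀ᵐ t ∂μ, c t ∈ Set.Icc 0 1) (hw : Integrable w μ)
    {l : ℝ}
    (hl : Tendsto (fun N => ∑ i ∈ range N, a i * ∫ t, c t ^ (r + 2 * i) * w t ∂μ) atTop (𝓝 l)) :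
    l = ∫ t, Q (c t) * w t ∂μ := by
  have hpow : Tendsto (fun z : ℝ => z ^ r) (𝓝[<] 1) (𝓝 1) := by
    simpa using ((continuous_pow r).tendsto (1 : ℝ)).mono_left nhdsWithin_le_nhds
  have habel := hpow.mul
    ((Real.tendsto_tsum_powerSeries_nhdsWithin_lt hl).comp tendsto_sq_nhdsLT_one)
  rw [one_mul] at habel
  refine tendsto_nhds_unique (habel.congr' ?_) (tendsto_integral_comp_mul hQ hc hc01 hw)
  filter_upwards [Ioo_mem_nhdsLT (zero_lt_one (α := ℝ))] with z hz
  rw [← (hasSum_integral_pow_mul hsum hc hc01 hw ⟨hz.1.le, hz.2⟩).tsum_eq, Function.comp_apply,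
    ← tsum_mul_left]
  refine tsum_congr fun i => ?_
  rw [pow_add z, pow_mul z]
  ring

end AbelSummation

section Evaluation

open Finset

theorem arctan_cayley {t : ℝ} (ht : t ∈ Set.Ioc 0 1) :
    Real.arctan (cayley t) = Real.pi / 4 - Real.arctan t := by
  have hlt : t * cayley t < 1 :=
    (mul_le_of_le_one_left (cayley_mem_Ico ht).1 ht.2).trans_lt (cayley_mem_Ico ht).2
  have hquot : (t + cayley t) / (1 - t * cayley t) = 1 := by
    have hne : 1 + t ≠ 0 := by linarith [ht.1]
    rw [div_eq_one_iff_eq (by linarith), cayley]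
    field
  rw [← Real.arctan_one, ← hquot, ← Real.arctan_add hlt, add_sub_cancel_left]

theorem dividedPow_arctan_cayley (r : ℕ) {t : ℝ} (ht : t ∈ Set.Ioc 0 1) :
    dividedPow r (2 * Real.arctan (cayley t)) / (1 + cayley t ^ 2) * (2 / (1 + t) ^ 2) =
      2 / (1 + t ^ 2) * coarctanPow r t / 2 := by
  have hne : 1 + t ≠ 0 := by linarith [ht.1]
  have hsq : 1 + cayley t ^ 2 = 2 * (1 + t ^ 2) / (1 + t) ^ 2 := by
    rw [cayley]
    field
  rw [arctan_cayley ht, hsq, coarctanPow, show 2 * (Real.pi / 4 - Real.arctan t) =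
    Real.pi / 2 - 2 * Real.arctan t by ring]
  field_simp

theorem hasSum_indexMTSum_zero_right (r : ℕ) {x : ℝ} (hx : x ∈ Set.Ico 0 1) :
    HasSum (fun i => (-1) ^ i * indexMTSum r 0 i * x ^ (r + 2 * i))
      (dividedPow r (2 * Real.arctan x) / (1 + x ^ 2)) :=
  mtPolylog_zero_right r hx ▸ hasSum_indexMTSum r 0 (by rw [abs_of_nonneg hx.1]; exact hx.2)

theorem tendsto_sum_indexMTSum_mul_cayleyMoment (r s : ℕ) :
    Tendsto (fun N => ∑ i ∈ range N, (-1) ^ i *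
        (indexMTSum r 0 i * cayleyMoment s (r + 2 * i + 1) / ((r : ℝ) + 1 + 2 * i)))
      atTop (𝓝 ((-1) ^ (r + 1) * sumW (r + 1 + s) (r + 1) / 2)) := by
  have hgrowth := ((powerGrowth_indexMTSum (a := 1 / 4) (by norm_num) (by norm_num) r 0).mul
    (powerGrowth_cayleyMoment (a := 1 / 4) (by norm_num) (by norm_num) s r)).div_pow
    (c := (r : ℝ) + 1) (by simp) le_rfl
  simp only [pow_one] at hgrowth
  obtain ⟨l, hl⟩ := hgrowth.exists_tendsto_alternating (by norm_num)
  have hmoment : ∀ i : ℕ, (-1) ^ i *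
      (indexMTSum r 0 i * cayleyMoment s (r + 2 * i + 1) / ((r : ℝ) + 1 + 2 * i)) =
        (-1) ^ i * indexMTSum r 0 i *
          ∫ t in Set.Ioc 0 1, cayley t ^ (r + 2 * i) * (2 / (1 + t) ^ 2 * logPow s t) := by
    intro i
    rw [← intervalIntegral.integral_of_le zero_le_one, ← cayleyMoment_div, mul_assoc, mul_div_assoc]
    push_cast
    rw [add_right_comm (r : ℝ)]
  have hw := intervalIntegrable_mul_logPow (continuousOn_two_div_one_add_pow 2) s
  rw [intervalIntegrable_iff_integrableOn_Ioc_of_le zero_le_one] at hw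
  have hQ : Continuous fun x : ℝ => dividedPow r (2 * Real.arctan x) / (1 + x ^ 2) :=
    ((continuous_dividedPow r).comp (by fun_prop)).div (by fun_prop) fun x => by positivity
  have hl_eq := eq_integral_of_tendsto_sum_mul_integral_pow hQ
    (fun _ => hasSum_indexMTSum_zero_right r)
    ((continuousOn_cayley.mono Set.Ioc_subset_Icc_self).aestronglyMeasurable measurableSet_Ioc)
    ((MeasureTheory.ae_restrict_mem measurableSet_Ioc).mono fun t ht =>
      Set.Ico_subset_Icc_self (cayley_mem_Ico ht)) hw (by simpa only [hmoment] using hl)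
  rw [← integral_coarctanPow_mul_logPow, ← intervalIntegral.integral_div,
    intervalIntegral.integral_of_le zero_le_one]
  convert! hl using 2
  rw [hl_eq]
  refine MeasureTheory.setIntegral_congr_fun measurableSet_Ioc fun t ht => ?_
  simp only [← mul_assoc, dividedPow_arctan_cayley r ht]
  ring

theorem onesTSum_mul_onesTSum_div (m p i : ℕ) :
    onesTSum (2 * m + 1) (m + 1 + i) * onesTSum (2 * p + 1) (m + 1 + i) / ((m + 1 + i : ℕ) : ℝ) *
        (-1) ^ (m + 1 + i) =
      (-1) ^ (m + 1) * ∑ j ∈ range (p + 1), coeffZ (j + 1) (p + 1) * (2 * ((-1) ^ i *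
        (indexMTSum (2 * m + 1) 0 i * cayleyMoment (2 * j + 1) (2 * m + 1 + 2 * i + 1) /
          (((2 * m + 1 : ℕ) : ℝ) + 1 + 2 * i)))) := by
  have hones : onesTSum (2 * m + 1) (m + 1 + i) = indexMTSum (2 * m + 1) 0 i := by
    rw [← onesTSum_add, show (2 * m + 1) / 2 = m by omega]
  rw [hones, onesTSum_eq_sum_coeffZ_mul_cayleyMoment,
    show 2 * (m + 1 + i) = 2 * m + 1 + 2 * i + 1 by ring]
  simp only [mul_sum, sum_div, sum_mul]
  refine sum_congr rfl fun j _ => ?_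
  push_cast
  field

theorem tendsto_sum_onesTSum_mul_onesTSum (m p : ℕ) :
    Tendsto (fun N => ∑ n ∈ Icc 1 N,
        onesTSum (2 * m + 1) n * onesTSum (2 * p + 1) n / (n : ℝ) * (-1) ^ n) atTop
      (𝓝 ((-1) ^ (m + 1) * ∑ j ∈ range (p + 1),
        coeffZ (j + 1) (p + 1) * sumW (2 * m + 1 + 1 + (2 * j + 1)) (2 * m + 1 + 1))) := by
  rw [← tendsto_add_atTop_iff_nat m]
  have hlim := (tendsto_finsetSum (range (p + 1)) fun j _ =>
    ((tendsto_sum_indexMTSum_mul_cayleyMoment (2 * m + 1) (2 * j + 1)).const_mul 2).const_mul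
      (coeffZ (j + 1) (p + 1))).const_mul ((-1) ^ (m + 1))
  have heven : (-1 : ℝ) ^ (2 * m + 1 + 1) = 1 := Even.neg_one_pow ⟨m + 1, by ring⟩
  simp only [heven, one_mul, mul_div_cancel₀ _ (two_ne_zero (α := ℝ))] at hlim
  refine hlim.congr fun K => ?_
  rw [add_comm K, sum_Icc_one_add_of_eq_zero fun n hn => ?_]
  · simp only [onesTSum_mul_onesTSum_div, ← mul_sum]
    rw [sum_comm]
    simp only [mul_sum]
  · rw [onesTSum_eq_zero (by omega) (by have := mem_Icc.1 hn; omega), zero_mul, zero_div, zero_mul]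

end Evaluation

theorem theorem3p2 (m p : ℕ) (hm : 1 ≤ m) (hp : 1 ≤ p) :
    -- every alternating multiple `T`-value on the right-hand side is a convergent series
    (∀ j ∈ Finset.Icc 1 p, ∀ k ∈ indexSet (2 * j + 2 * m - 1) (2 * m),
      Tendsto (altMTVPartialSum k) atTop (𝓝 (altMTV k))) ∧
    -- the alternating series on the left-hand side converges to the right-hand side
    Tendsto
      (fun N : ℕ => ∑ n ∈ Finset.Icc 1 N,
        multipleTHarmonicSum n (fun _ : Fin (2 * m - 1) => 1) *
          multipleTHarmonicSum n (fun _ : Fin (2 * p - 1) => 1) / (n : ℝ) * (-1 : ℝ) ^ n)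
      atTop
      (𝓝 ((-1 : ℝ) ^ m *
        ∑ j ∈ Finset.Icc 1 p, sumW (2 * j + 2 * m - 1) (2 * m) * coeffZ j p)) := by
  obtain ⟨m, rfl⟩ := Nat.exists_eq_add_of_le' hm
  obtain ⟨p, rfl⟩ := Nat.exists_eq_add_of_le' hp
  refine ⟨fun j _ k hk => tendsto_altMTVPartialSum (r := 2 * m + 1) (mem_indexSet.1 hk).1, ?_⟩
  have hsum : ∑ j ∈ Finset.Icc 1 (p + 1), sumW (2 * j + 2 * (m + 1) - 1) (2 * (m + 1)) *
      coeffZ j (p + 1) = ∑ j ∈ Finset.range (p + 1),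
        coeffZ (j + 1) (p + 1) * sumW (2 * m + 1 + 1 + (2 * j + 1)) (2 * m + 1 + 1) := by
    rw [← Finset.Ico_add_one_right_eq_Icc, Finset.sum_Ico_eq_sum_range, Nat.add_sub_cancel]
    refine Finset.sum_congr rfl fun j _ => ?_
    rw [mul_comm, add_comm 1 j, show 2 * (j + 1) + 2 * (m + 1) - 1 = 2 * m + 1 + 1 + (2 * j + 1) by
      omega, show 2 * (m + 1) = 2 * m + 1 + 1 by ring]
  rw [hsum]
  exact tendsto_sum_onesTSum_mul_onesTSum m p
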